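/- Let $D_i, D_o, L, M \ge 1$ be integers. Consider the fully connected network with $L$ hidden layers of width $M$, input $x\in\mathbb{R}^{D_i}$ and output in $\mathbb{R}^{D_o}$, $$z_1=\tfrac1{\sqrt{D_i}}W_1x+b_1,\qquad z_\ell=\tfrac1{\sqrt M}W_\ell\,\phi(z_{\ell-1})+b_\ell\ (2\le \ell\le L),\qquad f_\theta(x)=\tfrac1{\sqrt M}W_{L+1}\phi(z_L)+b_{L+1},$$ where $\phi:\mathbb{R}\to\mathbb{R}$ acts entrywise and $\theta$ collects all entries of $W_1,\dots,W_{L+1}$ and $b_1,\dots,b_{L+1}$. Suppose that $\phi$ is $1$-Lipschitz and that its even part is constant: $\tfrac12(\phi(a)+\phi(-a))=\alpha$ for all $a\in\mathbb{R}$, for some $\alpha\in\mathbb{R}$. Let $P=\mathcal{N}(0,I)$ and let $Q=\mathcal{N}(\mu,\operatorname{diag}(\sigma^2))$, with arbitrary means and arbitrary positive variances, be distributions of $\theta$, and let $\mathrm{KL}=\mathrm{KL}(Q,P)$ be the Kullback–Leibler divergence, which is finite. Put $\tilde f_\theta(x)=f_\theta(x)-\tfrac{\alpha}{\sqrt M}W_{L+1}\mathbf{1}-b_{L+1}$.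 Then, for every $x\in\mathbb{R}^{D_i}$, the entrywise squares $\tilde f_\theta(x)^2$ are integrable under $Q$ and under $P$, and $$\bigl\|\mathbb{E}_Q[\tilde f_\theta(x)^2]-\mathbb{E}_P[\tilde f_\theta(x)^2]\bigr\|_\infty\le c_1\,L^{1/2}\,\rho_{\alpha,M}^{\,L}\;\frac{\alpha^2+1+\frac1{D_i}\|x\|_2^2}{\sqrt M}\;\sqrt{\mathrm{KL}}\;\bigl(\max(2\,\mathrm{KL},1)\bigr)^{L+\frac12},$$ where $c_1=16+25\sqrt2\in(51,52)$ and $\rho_{\alpha,M}\in(17,97)$ is given by $$\rho_{\alpha,M}=\begin{cases}12(2+\sqrt{2\pi}) & \alpha=0,\ M<36,\\ \tfrac23(13+2\sqrt{43}) & \alpha=0,\ M\ge 36,\\ 28+\sqrt{793} & \alpha\ne0,\ M<36,\\ 48+\sqrt{2353} & \alpha\neq 0,\ M\ge 36.\end{cases}$$ The same bound also holds with the two values for $\alpha\ne0$ interchanged, that is, with $48+\sqrt{2353}$ for $M<36$ and $28+\sqrt{793}$ for $M\ge36$. -/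

import Mathlib

open MeasureTheory ProbabilityTheory
open scoped NNReal ENNReal

/-- Index type of the scalar parameters of a fully connected network with input dimension `Di`,
output dimension `Do`, and `L` hidden layers of width `M`. -/
inductive ParamIdx (Di Do M L : ℕ) : Type
  | inWeight (i : Fin M) (j : Fin Di)
  | inBias (i : Fin M)
  /-- `hidWeight l` is the weight matrix between hidden layers `l + 1` and `l + 2` (1-based). -/
  | hidWeight (l : Fin (L - 1)) (i j : Fin M)
  | hidBias (l : Fin (L - 1)) (i : Fin M)
  | outWeight (i : Fin Do) (j : Fin M)
  | outBias (i : Fin Do)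
  deriving DecidableEq, Fintype

/-- A concrete value of all the parameters of the network. -/
abbrev Params (Di Do M L : ℕ) : Type := ParamIdx Di Do M L → ℝ

noncomputable section

/-- Preactivations: `preact φ θ x l _` is the vector `z_{l+1}` of hidden layer `l + 1` (1-based). -/
def preact {Di Do M L : ℕ} (φ : ℝ → ℝ) (θ : Params Di Do M L)
    (x : EuclideanSpace ℝ (Fin Di)) : (l : ℕ) → l < L → Fin M → ℝ
  | 0, _ => fun i =>
      1 / √(Di : ℝ) * ∑ j, θ (.inWeight i j) * x j + θ (.inBias i)
  | l + 1, h => fun i =>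
      1 / √(M : ℝ) *
          ∑ j, θ (.hidWeight ⟨l, by omega⟩ i j) * φ (preact φ θ x l (by omega) j)
        + θ (.hidBias ⟨l, by omega⟩ i)

/-- The network output `f_θ(x) = M^{-1/2} W_{L+1} φ(z_L) + b_{L+1}`. -/
def network {Di Do M L : ℕ} (hL : 1 ≤ L) (φ : ℝ → ℝ) (θ : Params Di Do M L)
    (x : EuclideanSpace ℝ (Fin Di)) : Fin Do → ℝ := fun i =>
  1 / √(M : ℝ) *
      ∑ j, θ (.outWeight i j) * φ (preact φ θ x (L - 1) (by omega) j)
    + θ (.outBias i)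

/-- The network output without the final bias and the constant `α` of the last activation:
`f_θ(x) - (α / √M) W_{L+1} 1 - b_{L+1}`. -/
def networkTilde {Di Do M L : ℕ} (hL : 1 ≤ L) (φ : ℝ → ℝ) (α : ℝ) (θ : Params Di Do M L)
    (x : EuclideanSpace ℝ (Fin Di)) : Fin Do → ℝ := fun i =>
  network hL φ θ x i - α / √(M : ℝ) * ∑ j, θ (.outWeight i j) - θ (.outBias i)

/-- The even part of a function. -/
def evenPart (φ : ℝ → ℝ) (a : ℝ) : ℝ := (φ a + φ (-a)) / 2

/-- The factorized Gaussian distribution with means `μ i` and variances `v i`. -/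
def meanFieldGaussian {ι : Type} [Fintype ι] (μ : ι → ℝ) (v : ι → ℝ≥0) : Measure (ι → ℝ) :=
  Measure.pi fun i => gaussianReal (μ i) (v i)

/-- The standard Gaussian prior `N(0, I)`. -/
def stdPrior (ι : Type) [Fintype ι] : Measure (ι → ℝ) :=
  meanFieldGaussian (fun _ => 0) (fun _ => 1)

/-- The constant `c₁`. -/
def cOne : ℝ := 16 + 25 * √2

/-- The constant `ρ_{α,M}`, with the case distinction for `α ≠ 0` as in the displayed table. -/
def rho (α : ℝ) (M : ℕ) : ℝ :=
  if α = 0 then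
    if M < 36 then 12 * (2 + √(2 * Real.pi)) else 2 / 3 * (13 + 2 * √43)
  else
    if M < 36 then 28 + √793 else 48 + √2353

/-- The variant of `ρ_{α,M}` in which the two values for `α ≠ 0` are interchanged. -/
def rhoSwap (α : ℝ) (M : ℕ) : ℝ :=
  if α = 0 then
    if M < 36 then 12 * (2 + √(2 * Real.pi)) else 2 / 3 * (13 + 2 * √43)
  else
    if M < 36 then 48 + √2353 else 28 + √793

end

/-! The measure $Q$ is the image of $P$ under $\omega\mapsto\mu+\sigma\omega$
(`map_affine_stdPrior`), so both moments are integrals over one standard Gaussian $\omega$ and the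
two networks can be compared under this coupling. The divergence of factorized Gaussians is
explicit, and `klDiv_meanFieldGaussian_stdPrior` turns it into a budget:
$\sum_k(\mu_k^2+(\sigma_k-1)^2)\le 2\,\mathrm{KL}=q^2$.

Each unit is a linear form in its own parameters, which are independent of all earlier layers. In
second moments the contributions of these fresh coordinates therefore add without cross terms
(`sqIntegrableOn_add_sum_eval_mul`). Prior second moments of preactivations stay bounded
independently of $M$. Moreover, `couplingDist_le` bounds the squared distance summed, not averaged,
over a whole layer independently of $M$, because all units share the single budget $q^2$.

The output moments carry a factor $1/M$, so their unnormalized difference has to be $O(\sqrt M)$.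
Let $A_j$, $B_j$ be the second moments of the centred last activations under $Q$ and $P$. The terms
$\sum_j|\sigma_j-1|$ and $\sum_j|A_j-B_j|$ cost $\sqrt M\,q$ by Cauchy–Schwarz and by Young's
inequality with a tuned weight. The form $\sum_j\mu_j(\phi(z_j)-\alpha)$ could cost $Mq^2$; here the
even part matters. Since $\phi-\alpha$ is odd, flipping the signs of the parameters entering one
unit preserves $P$ and flips only that centred activation. Centred activations are thus orthogonal
under $P$, and the cost drops to order $q^2$ (`integral_sum_mul_centered_sq`).

The argument yields the constant $19\sqrt2\cdot10^L$, which both tables for $\rho$ dominate. -/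

/-! ### One-dimensional Gaussian densities relative to $N(0,1)$ -/

section GaussianDensity

/-- Logarithm of the density of `N(m, w)` with respect to `N(0, 1)`. -/
noncomputable def gaussianLogRatio (m : ℝ) (w : ℝ≥0) (y : ℝ) : ℝ :=
  -(Real.log w / 2) - (y - m) ^ 2 / (2 * w) + y ^ 2 / 2

lemma measurable_gaussianLogRatio (m : ℝ) (w : ℝ≥0) : Measurable (gaussianLogRatio m w) := by
  unfold gaussianLogRatio
  fun_prop

lemma gaussianPDFReal_eq_mul_exp_gaussianLogRatio (m : ℝ) {w : ℝ≥0} (hw : 0 < w) (y : ℝ) :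
    gaussianPDFReal m w y = gaussianPDFReal 0 1 y * Real.exp (gaussianLogRatio m w y) := by
  have hw' : (0 : ℝ) < w := hw
  have h1 : Real.exp (-(Real.log w / 2)) = (√(w : ℝ))⁻¹ := by
    rw [Real.exp_neg, ← Real.log_sqrt hw'.le, Real.exp_log (Real.sqrt_pos.2 hw')]
  have h2 : gaussianLogRatio m w y =
      -(Real.log w / 2) + (-(y - m) ^ 2 / (2 * w)) + y ^ 2 / 2 := by
    unfold gaussianLogRatio
    ring
  rw [gaussianPDFReal_def, gaussianPDFReal_def, h2, Real.exp_add, Real.exp_add, h1]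
  have h3 : Real.exp (-(y - 0) ^ 2 / (2 * ((1 : ℝ≥0) : ℝ))) * Real.exp (y ^ 2 / 2) = 1 := by
    rw [← Real.exp_add, ← Real.exp_zero]
    congr 1
    push_cast
    ring
  have h4 : (√(2 * Real.pi * w))⁻¹ = (√(2 * Real.pi * ((1 : ℝ≥0) : ℝ)))⁻¹ * (√(w : ℝ))⁻¹ := by
    rw [← mul_inv, Real.sqrt_mul (by positivity) (w : ℝ)]
    simp
  simp only [h4]
  linear_combination (-(√(2 * Real.pi * ((1 : ℝ≥0) : ℝ)))⁻¹ * (√(w : ℝ))⁻¹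
    * Real.exp (-(y - m) ^ 2 / (2 * w))) * h3

lemma gaussianReal_eq_withDensity_std (m : ℝ) {w : ℝ≥0} (hw : 0 < w) :
    gaussianReal m w = (gaussianReal 0 1).withDensity
      (fun y => ENNReal.ofReal (Real.exp (gaussianLogRatio m w y))) := by
  rw [gaussianReal_of_var_ne_zero _ hw.ne', gaussianReal_of_var_ne_zero _ one_ne_zero,
    ← withDensity_mul _ (measurable_gaussianPDF _ _)
      (measurable_gaussianLogRatio m w).exp.ennreal_ofReal]
  congr 1
  ext y
  rw [Pi.mul_apply, gaussianPDF, gaussianPDF, ← ENNReal.ofReal_mul (gaussianPDFReal_nonneg _ _ _),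
    gaussianPDFReal_eq_mul_exp_gaussianLogRatio m hw]

lemma integrable_sq_gaussianReal (m : ℝ) (w : ℝ≥0) :
    Integrable (fun y => y ^ 2) (gaussianReal m w) := by
  simpa using (memLp_id_gaussianReal' (μ := m) (v := w) 2 (by simp)).integrable_sq

lemma integrable_id_gaussianReal (m : ℝ) (w : ℝ≥0) :
    Integrable (fun y => y) (gaussianReal m w) := by
  exact (memLp_id_gaussianReal' (μ := m) (v := w) 1 (by simp)).integrable le_rfl

lemma integral_sq_gaussianReal (m : ℝ) (w : ℝ≥0) :
    ∫ y, y ^ 2 ∂gaussianReal m w = w + m ^ 2 := by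
  have h := variance_eq_sub (memLp_id_gaussianReal' (μ := m) (v := w) 2 (by simp))
  rw [variance_id_gaussianReal] at h
  simp only [Pi.pow_apply, id_eq, integral_id_gaussianReal] at h
  linarith

lemma gaussianLogRatio_eq_quadratic (m : ℝ) (w : ℝ≥0) :
    gaussianLogRatio m w = fun y => ((1 / 2 - 1 / (2 * (w : ℝ))) * y ^ 2 + (m / w) * y)
      + (-(Real.log w / 2) - m ^ 2 / (2 * w)) := by
  ext y
  unfold gaussianLogRatio
  ring

lemma integrable_gaussianLogRatio (m : ℝ) (w : ℝ≥0) :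
    Integrable (gaussianLogRatio m w) (gaussianReal m w) := by
  have h1 := integrable_sq_gaussianReal m w
  have h2 := integrable_id_gaussianReal m w
  rw [gaussianLogRatio_eq_quadratic]
  exact ((h1.const_mul _).add (h2.const_mul _)).add (integrable_const _)

lemma integral_gaussianLogRatio (m : ℝ) {w : ℝ≥0} (hw : 0 < w) :
    ∫ y, gaussianLogRatio m w y ∂gaussianReal m w = (m ^ 2 + w - 1 - Real.log w) / 2 := by
  have hw' : (w : ℝ) ≠ 0 := by exact_mod_cast hw.ne'
  have h1 := integrable_sq_gaussianReal m w
  have h2 := integrable_id_gaussianReal m w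
  rw [gaussianLogRatio_eq_quadratic,
    integral_add (by exact (h1.const_mul _).add (h2.const_mul _)) (integrable_const _),
    integral_add (h1.const_mul _) (h2.const_mul _), integral_const_mul, integral_const_mul,
    integral_sq_gaussianReal, integral_id_gaussianReal]
  simp only [integral_const, probReal_univ, smul_eq_mul, one_mul]
  field_simp
  ring

/-- This is $\log\sqrt w\le\sqrt w-1$, doubled and rearranged. It converts the variance part of the
divergence into a distance between standard deviations. -/
lemma sq_sqrt_sub_one_le (w : ℝ) (hw : 0 < w) : (√w - 1) ^ 2 ≤ w - 1 - Real.log w := by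
  have h1 := Real.log_le_sub_one_of_pos (Real.sqrt_pos.2 hw)
  rw [Real.log_sqrt hw.le] at h1
  nlinarith [Real.sq_sqrt hw.le]

end GaussianDensity

/-! ### Factorized Gaussians: density, divergence, coupling and sign symmetry -/

section MeanField

variable {ι : Type} [Fintype ι]

instance (μ : ι → ℝ) (v : ι → ℝ≥0) : IsProbabilityMeasure (meanFieldGaussian μ v) := by
  unfold meanFieldGaussian
  infer_instance

instance : IsProbabilityMeasure (stdPrior ι) := by
  unfold stdPrior
  infer_instance

lemma measurePreserving_eval_meanFieldGaussian (μ : ι → ℝ) (v : ι → ℝ≥0) (i : ι) :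
    MeasurePreserving (Function.eval i) (meanFieldGaussian μ v) (gaussianReal (μ i) (v i)) :=
  measurePreserving_eval _ i

lemma iIndepFun_eval_meanFieldGaussian (μ : ι → ℝ) (v : ι → ℝ≥0) :
    iIndepFun (fun i (ω : ι → ℝ) => ω i) (meanFieldGaussian μ v) :=
  iIndepFun_pi (X := fun _ => id) (fun _ => aemeasurable_id)

/-- A product measure is determined on boxes. There the density times the indicator is a product of
functions of single coordinates, so independence factors the integral. -/
lemma meanFieldGaussian_eq_withDensity (μ : ι → ℝ) (v : ι → ℝ≥0) (hv : ∀ i, 0 < v i) :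
    meanFieldGaussian μ v = (stdPrior ι).withDensity
      (fun ω => ENNReal.ofReal (Real.exp (∑ i, gaussianLogRatio (μ i) (v i) (ω i)))) := by
  classical
  refine Measure.pi_eq fun s hs => ?_
  have hmeas : ∀ i, Measurable fun y =>
      (s i).indicator (fun y => ENNReal.ofReal (Real.exp (gaussianLogRatio (μ i) (v i) y))) y :=
    fun i => ((measurable_gaussianLogRatio _ _).exp.ennreal_ofReal).indicator (hs i)
  have hind := (iIndepFun_eval_meanFieldGaussian (fun _ : ι => (0 : ℝ)) (fun _ => 1)).comp _ hmeas
  have hprod := lintegral_prod_eq_prod_lintegral_of_indepFun Finset.univ _ hind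
    (fun i => (hmeas i).comp (measurable_pi_apply i))
  rw [withDensity_apply _ (MeasurableSet.univ_pi hs),
    ← lintegral_indicator (MeasurableSet.univ_pi hs)]
  have h1 : ∀ ω : ι → ℝ, (Set.univ.pi s).indicator (fun ω => ENNReal.ofReal
      (Real.exp (∑ i, gaussianLogRatio (μ i) (v i) (ω i)))) ω
      = ∏ i, (s i).indicator
        (fun y => ENNReal.ofReal (Real.exp (gaussianLogRatio (μ i) (v i) y))) (ω i) := by
    intro ω
    by_cases h : ω ∈ Set.univ.pi s
    · rw [Set.indicator_of_mem h, Real.exp_sum, ENNReal.ofReal_prod_of_nonneg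
        (fun i _ => (Real.exp_pos _).le)]
      exact Finset.prod_congr rfl fun i _ => by rw [Set.indicator_of_mem (h i trivial)]
    · rw [Set.indicator_of_notMem h]
      obtain ⟨i, hi⟩ : ∃ i, ω i ∉ s i := by simpa using h
      exact (Finset.prod_eq_zero (Finset.mem_univ i) (Set.indicator_of_notMem hi _)).symm
  simp only [h1]
  refine hprod.trans (Finset.prod_congr rfl fun i _ => ?_)
  rw [gaussianReal_eq_withDensity_std (μ i) (hv i), withDensity_apply _ (hs i),
    ← lintegral_indicator (hs i),
    ← (measurePreserving_eval_meanFieldGaussian (fun _ : ι => (0 : ℝ)) (fun _ => 1) i).lintegral_comp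
      (hmeas i)]
  rfl

lemma llr_meanFieldGaussian (μ : ι → ℝ) (v : ι → ℝ≥0) (hv : ∀ i, 0 < v i) :
    llr (meanFieldGaussian μ v) (stdPrior ι) =ᵐ[meanFieldGaussian μ v]
      fun ω => ∑ i, gaussianLogRatio (μ i) (v i) (ω i) := by
  have hm : Measurable fun ω : ι → ℝ => ∑ i, gaussianLogRatio (μ i) (v i) (ω i) :=
    Finset.measurable_sum _ fun i _ =>
      (measurable_gaussianLogRatio _ _).comp (measurable_pi_apply i)
  have h := Measure.rnDeriv_withDensity (stdPrior ι) hm.exp.ennreal_ofReal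
  rw [← meanFieldGaussian_eq_withDensity μ v hv] at h
  have hac : meanFieldGaussian μ v ≪ stdPrior ι := by
    rw [meanFieldGaussian_eq_withDensity μ v hv]
    exact withDensity_absolutelyContinuous _ _
  filter_upwards [hac.ae_le h] with ω hω
  rw [llr, hω, ENNReal.toReal_ofReal (Real.exp_pos _).le, Real.log_exp]

/-- The Kullback-Leibler divergence of a factorized Gaussian from the standard Gaussian is finite
and controls the squared Euclidean distance of means and standard deviations. -/
theorem klDiv_meanFieldGaussian_stdPrior (μ : ι → ℝ) (v : ι → ℝ≥0) (hv : ∀ i, 0 < v i) :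
    InformationTheory.klDiv (meanFieldGaussian μ v) (stdPrior ι) ≠ ∞ ∧
    ∑ i, (μ i ^ 2 + (√(v i : ℝ) - 1) ^ 2)
      ≤ 2 * (InformationTheory.klDiv (meanFieldGaussian μ v) (stdPrior ι)).toReal := by
  have hac : meanFieldGaussian μ v ≪ stdPrior ι := by
    rw [meanFieldGaussian_eq_withDensity μ v hv]
    exact withDensity_absolutelyContinuous _ _
  have hllr := llr_meanFieldGaussian μ v hv
  have hi : ∀ i, Integrable (fun ω : ι → ℝ => gaussianLogRatio (μ i) (v i) (ω i))
      (meanFieldGaussian μ v) := fun i =>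
    (measurePreserving_eval_meanFieldGaussian μ v i).integrable_comp_of_integrable
      (integrable_gaussianLogRatio (μ i) (v i))
  have hint : Integrable (llr (meanFieldGaussian μ v) (stdPrior ι)) (meanFieldGaussian μ v) :=
    (integrable_congr hllr).2 (integrable_finsetSum _ fun i _ => hi i)
  refine ⟨InformationTheory.klDiv_ne_top hac hint, ?_⟩
  rw [InformationTheory.toReal_klDiv_of_measure_eq hac (by simp), integral_congr_ae hllr,
    integral_finsetSum _ fun i _ => hi i, Finset.mul_sum]
  refine Finset.sum_le_sum fun i _ => ?_
  have h : ∫ ω, gaussianLogRatio (μ i) (v i) (ω i) ∂meanFieldGaussian μ v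
      = ∫ y, gaussianLogRatio (μ i) (v i) y ∂gaussianReal (μ i) (v i) := by
    rw [← (measurePreserving_eval_meanFieldGaussian μ v i).map_eq,
      integral_map (measurable_pi_apply i).aemeasurable
        (measurable_gaussianLogRatio _ _).aestronglyMeasurable]
  rw [h, integral_gaussianLogRatio _ (hv i)]
  have := sq_sqrt_sub_one_le (v i) (hv i)
  linarith

/-- This is the coupling of posterior and prior used throughout. -/
lemma map_affine_stdPrior (μ : ι → ℝ) (v : ι → ℝ≥0) :
    (stdPrior ι).map (fun ε i => μ i + √(v i : ℝ) * ε i) = meanFieldGaussian μ v := by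
  unfold stdPrior meanFieldGaussian
  rw [Measure.pi_map_pi (f := fun i y => μ i + √(v i : ℝ) * y) (fun i => by fun_prop)]
  congr 1
  ext1 i
  have : (fun y => μ i + √(v i : ℝ) * y) = (fun y => μ i + y) ∘ fun y => √(v i : ℝ) * y := rfl
  rw [this, ← Measure.map_map (by fun_prop) (by fun_prop), gaussianReal_map_const_mul,
    gaussianReal_map_const_add]
  congr 1
  · ring
  · ext
    simp

lemma map_sign_stdPrior (τ : ι → ℝ) (hτ : ∀ i, τ i ^ 2 = 1) :
    (stdPrior ι).map (fun ε i => τ i * ε i) = stdPrior ι := by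
  unfold stdPrior meanFieldGaussian
  rw [Measure.pi_map_pi (f := fun i y => τ i * y) (fun i => by fun_prop)]
  congr 1
  ext1 i
  rw [gaussianReal_map_const_mul]
  congr 1
  · ring
  · ext
    simp [hτ i]

end MeanField

/-! ### Second moments of linear forms in fresh independent coordinates -/

section Innovation

lemma measurable_domExtend_of_dependsOn {ι : Type} {S : Set ι} {g : (ι → ℝ) → ℝ} (hg : Measurable g)
    (hS : DependsOn g S) :
    ∃ h : (S → ℝ) → ℝ, Measurable h ∧ ∀ ω, g ω = h (fun i => ω i) := by
  classical
  refine ⟨fun y => g fun i => if hi : i ∈ S then y ⟨i, hi⟩ else 0, ?_, fun ω => hS fun i hi => ?_⟩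
  · refine hg.comp (measurable_pi_lambda _ fun i => ?_)
    by_cases hi : i ∈ S
    · simpa [hi] using measurable_pi_apply _
    · simp [hi]
  · simp [hi]

variable {ι : Type} [Fintype ι]

/-- A function depending only on $S$ factors measurably through the coordinates in $S$, and disjoint
blocks of coordinates are independent. -/
lemma indepFun_eval_of_dependsOn {S : Set ι} {k : ι} (hk : k ∉ S) {g : (ι → ℝ) → ℝ}
    (hg : Measurable g) (hS : DependsOn g S) :
    IndepFun (fun ω : ι → ℝ => ω k) g (stdPrior ι) := by
  classical
  have hS' : DependsOn g ((Finset.univ.filter fun i => i ∈ S : Finset ι) : Set ι) := by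
    simpa using hS
  obtain ⟨h, hm, he⟩ := measurable_domExtend_of_dependsOn hg hS'
  have h1 := (iIndepFun_eval_meanFieldGaussian (fun _ : ι => (0 : ℝ)) (fun _ => 1)).indepFun_finset
    {k} (Finset.univ.filter fun i => i ∈ S) (by simpa using hk) (fun i => measurable_pi_apply i)
  have hmk : Measurable fun y : ({k} : Finset ι) → ℝ => y ⟨k, Finset.mem_singleton_self k⟩ :=
    measurable_pi_apply _
  have h2 := h1.comp hmk hm
  have h3 : g = h ∘ fun (ω : ι → ℝ) (i : (Finset.univ.filter fun i => i ∈ S : Finset ι)) => ω i :=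
    funext he
  rw [h3]
  exact h2

lemma memLp_eval_stdPrior (k : ι) : MemLp (fun ω : ι → ℝ => ω k) 2 (stdPrior ι) :=
  (memLp_id_gaussianReal' (μ := 0) (v := 1) 2 (by simp)).comp_measurePreserving
    (measurePreserving_eval_meanFieldGaussian (fun _ : ι => (0 : ℝ)) (fun _ => 1) k)

lemma integral_eval_stdPrior (k : ι) : ∫ ω, ω k ∂stdPrior ι = 0 := by
  have h := integral_id_gaussianReal (μ := 0) (v := 1)
  rw [← (measurePreserving_eval_meanFieldGaussian (fun _ : ι => (0 : ℝ)) (fun _ => 1) k).map_eq,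
    integral_map (measurable_pi_apply k).aemeasurable (by fun_prop)] at h
  exact h

lemma integral_eval_sq_stdPrior (k : ι) : ∫ ω, ω k ^ 2 ∂stdPrior ι = 1 := by
  have h := integral_sq_gaussianReal 0 1
  rw [← (measurePreserving_eval_meanFieldGaussian (fun _ : ι => (0 : ℝ)) (fun _ => 1) k).map_eq,
    integral_map (measurable_pi_apply k).aemeasurable (by fun_prop)] at h
  simpa [stdPrior] using h

/-- Square-integrable, measurable functions of the coordinates in `S`. -/
structure SqIntegrableOn (S : Set ι) (g : (ι → ℝ) → ℝ) : Prop where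
  measurable : Measurable g
  dependsOn : DependsOn g S
  memLp : MemLp g 2 (stdPrior ι)

namespace SqIntegrableOn

variable {S T : Set ι} {g h : (ι → ℝ) → ℝ}

lemma mono (hg : SqIntegrableOn S g) (hST : S ⊆ T) : SqIntegrableOn T g :=
  ⟨hg.measurable, hg.dependsOn.mono hST, hg.memLp⟩

lemma const (c : ℝ) : SqIntegrableOn S (fun _ => c) :=
  ⟨measurable_const, fun _ _ _ => rfl, memLp_const c⟩

lemma add (hg : SqIntegrableOn S g) (hh : SqIntegrableOn S h) :
    SqIntegrableOn S (fun ω => g ω + h ω) :=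
  ⟨hg.measurable.add hh.measurable,
    fun _ _ hxy => congrArg₂ (· + ·) (hg.dependsOn hxy) (hh.dependsOn hxy), hg.memLp.add hh.memLp⟩

lemma sub (hg : SqIntegrableOn S g) (hh : SqIntegrableOn S h) :
    SqIntegrableOn S (fun ω => g ω - h ω) :=
  ⟨hg.measurable.sub hh.measurable,
    fun _ _ hxy => congrArg₂ (· - ·) (hg.dependsOn hxy) (hh.dependsOn hxy), hg.memLp.sub hh.memLp⟩

lemma const_mul (hg : SqIntegrableOn S g) (c : ℝ) : SqIntegrableOn S (fun ω => c * g ω) :=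
  ⟨hg.measurable.const_mul c, fun _ _ hxy => congrArg (c * ·) (hg.dependsOn hxy),
    hg.memLp.const_mul c⟩

lemma sum {J : Type} {g : J → (ι → ℝ) → ℝ} (s : Finset J) (hg : ∀ j, SqIntegrableOn S (g j)) :
    SqIntegrableOn S (fun ω => ∑ j ∈ s, g j ω) :=
  ⟨Finset.measurable_sum _ fun j _ => (hg j).measurable,
    fun _ _ hxy => Finset.sum_congr rfl fun j _ => (hg j).dependsOn hxy,
    memLp_finsetSum _ fun j _ => (hg j).memLp⟩

lemma lipschitz_comp (hg : SqIntegrableOn S g) {φ : ℝ → ℝ} (hφ : LipschitzWith 1 φ) :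
    SqIntegrableOn S (fun ω => φ (g ω)) := by
  refine ⟨hφ.continuous.measurable.comp hg.measurable,
    fun _ _ hxy => congrArg φ (hg.dependsOn hxy), ?_⟩
  have hm : AEStronglyMeasurable (fun ω => φ (g ω)) (stdPrior ι) :=
    (hφ.continuous.measurable.comp hg.measurable).aestronglyMeasurable
  refine (hg.memLp.norm.add (memLp_const ‖φ 0‖)).mono hm
    (Filter.Eventually.of_forall fun ω => ?_)
  have h1 := hφ.dist_le_mul (g ω) 0
  simp only [NNReal.coe_one, one_mul, Real.dist_eq, sub_zero] at h1
  simp only [Pi.add_apply, Real.norm_eq_abs]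
  rw [abs_of_nonneg (a := |g ω| + |φ 0|) (by positivity)]
  have h2 := abs_sub_abs_le_abs_sub (φ (g ω)) (φ 0)
  linarith

lemma integrable_sq (hg : SqIntegrableOn S g) : Integrable (fun ω => g ω ^ 2) (stdPrior ι) :=
  hg.memLp.integrable_sq

lemma integrable_mul (hg : SqIntegrableOn S g) (hh : SqIntegrableOn S h) :
    Integrable (fun ω => g ω * h ω) (stdPrior ι) :=
  hg.memLp.integrable_mul hh.memLp

lemma add_eval_mul (hg : SqIntegrableOn S g) (hh : SqIntegrableOn S h) {k : ι} (hk : k ∉ S) :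
    SqIntegrableOn (insert k S) (fun ω => g ω + ω k * h ω) := by
  refine (hg.mono (Set.subset_insert _ _)).add ⟨by have := hh.measurable; fun_prop, ?_, ?_⟩
  · intro x y hxy
    simp only [hxy k (Set.mem_insert _ _),
      hh.dependsOn fun i hi => hxy i (Set.mem_insert_of_mem _ hi)]
  · have hm : Measurable fun ω : ι → ℝ => ω k * h ω := by have := hh.measurable; fun_prop
    rw [memLp_two_iff_integrable_sq hm.aestronglyMeasurable]
    simp only [mul_pow]
    have hi := (indepFun_eval_of_dependsOn hk hh.measurable hh.dependsOn).comp
      (φ := fun y => y ^ 2) (ψ := fun y => y ^ 2) (by fun_prop) (by fun_prop)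
    exact hi.integrable_mul (memLp_eval_stdPrior k).integrable_sq hh.integrable_sq

/-- The cross term vanishes because $\omega_k$ is centred and independent of $gh$; in the last term
$\omega_k^2$ has mean $1$ and is independent of $h^2$. -/
lemma integral_add_eval_mul_sq (hg : SqIntegrableOn S g) (hh : SqIntegrableOn S h) {k : ι}
    (hk : k ∉ S) :
    ∫ ω, (g ω + ω k * h ω) ^ 2 ∂stdPrior ι
      = ∫ ω, g ω ^ 2 ∂stdPrior ι + ∫ ω, h ω ^ 2 ∂stdPrior ι := by
  have hgh : IndepFun (fun ω : ι → ℝ => ω k) (fun ω => g ω * h ω) (stdPrior ι) :=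
    indepFun_eval_of_dependsOn hk (hg.measurable.mul hh.measurable)
      fun _ _ hxy => congrArg₂ (· * ·) (hg.dependsOn hxy) (hh.dependsOn hxy)
  have hi := (indepFun_eval_of_dependsOn hk hh.measurable hh.dependsOn).comp
    (φ := fun y => y ^ 2) (ψ := fun y => y ^ 2) (by fun_prop) (by fun_prop)
  have i1 : Integrable (fun ω : ι → ℝ => ω k * (g ω * h ω)) (stdPrior ι) :=
    hgh.integrable_mul ((memLp_eval_stdPrior k).integrable one_le_two) (hg.integrable_mul hh)
  have i2 : Integrable (fun ω : ι → ℝ => ω k ^ 2 * h ω ^ 2) (stdPrior ι) :=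
    hi.integrable_mul (memLp_eval_stdPrior k).integrable_sq hh.integrable_sq
  have e1 : ∫ ω, ω k * (g ω * h ω) ∂stdPrior ι = 0 := by
    rw [hgh.integral_fun_mul_eq_mul_integral
      (measurable_pi_apply k).aestronglyMeasurable
      (hg.integrable_mul hh).aestronglyMeasurable, integral_eval_stdPrior, zero_mul]
  have e2 : ∫ ω, ω k ^ 2 * h ω ^ 2 ∂stdPrior ι = ∫ ω, h ω ^ 2 ∂stdPrior ι := by
    have := hi.integral_mul_eq_mul_integral
      (memLp_eval_stdPrior k).integrable_sq.aestronglyMeasurable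
      hh.integrable_sq.aestronglyMeasurable
    have h1 := integral_eval_sq_stdPrior k
    simp only [Function.comp_def, Pi.mul_apply] at this
    rw [this, h1, one_mul]
  have : ∀ ω : ι → ℝ, (g ω + ω k * h ω) ^ 2
      = (g ω ^ 2 + 2 * (ω k * (g ω * h ω))) + ω k ^ 2 * h ω ^ 2 := fun ω => by ring
  simp only [this]
  rw [integral_add (by exact hg.integrable_sq.add (i1.const_mul 2)) i2,
    integral_add hg.integrable_sq (i1.const_mul 2), integral_const_mul, e1, e2]
  ring

end SqIntegrableOn

/-- Coordinates are added one at a time. Injectivity of `k` keeps each new coordinate outside those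
already used, so it is independent of the partial sum. -/
lemma sqIntegrableOn_add_sum_eval_mul {S : Set ι} {J : Type} {k : J → ι}
    (hk : Function.Injective k) (hkS : ∀ j, k j ∉ S) {c : (ι → ℝ) → ℝ} {u : J → (ι → ℝ) → ℝ}
    (hc : SqIntegrableOn S c) (hu : ∀ j, SqIntegrableOn S (u j)) (s : Finset J) :
    SqIntegrableOn (S ∪ k '' s) (fun ω => c ω + ∑ j ∈ s, ω (k j) * u j ω) ∧
    ∫ ω, (c ω + ∑ j ∈ s, ω (k j) * u j ω) ^ 2 ∂stdPrior ι
      = ∫ ω, c ω ^ 2 ∂stdPrior ι + ∑ j ∈ s, ∫ ω, u j ω ^ 2 ∂stdPrior ι := by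
  classical
  induction s using Finset.induction_on with
  | empty => simpa using hc
  | insert j s hj ih =>
    have hkj : k j ∉ S ∪ k '' s := by
      rintro (h | ⟨j', h, e⟩)
      · exact hkS j h
      · exact hj (hk e ▸ h)
    have huj := (hu j).mono (Set.subset_union_left (t := k '' s))
    have e : ∀ ω : ι → ℝ, c ω + ∑ j ∈ insert j s, ω (k j) * u j ω
        = (c ω + ∑ j ∈ s, ω (k j) * u j ω) + ω (k j) * u j ω := fun ω => by
      rw [Finset.sum_insert hj]
      ring
    simp only [e]
    refine ⟨(ih.1.add_eval_mul huj hkj).mono ?_, ?_⟩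
    · rw [Finset.coe_insert, Set.image_insert_eq, Set.union_insert]
    · rw [ih.1.integral_add_eval_mul_sq huj hkj, ih.2, Finset.sum_insert hj]
      ring

/-- Second moment of a sum of fresh independent parameters `m j + d j * ω (k j)`, weighted by
functions `a j` of the previous coordinates. -/
lemma integral_sum_affine_eval_mul_sq {S : Set ι} {J : Type} [Fintype J] {k : J → ι}
    (hk : Function.Injective k) (hkS : ∀ j, k j ∉ S) (m d : J → ℝ) {a : J → (ι → ℝ) → ℝ}
    (ha : ∀ j, SqIntegrableOn S (a j)) :
    SqIntegrableOn (S ∪ Set.range k) (fun ω => ∑ j, (m j + d j * ω (k j)) * a j ω) ∧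
    ∫ ω, (∑ j, (m j + d j * ω (k j)) * a j ω) ^ 2 ∂stdPrior ι
      = ∫ ω, (∑ j, m j * a j ω) ^ 2 ∂stdPrior ι
        + ∑ j, d j ^ 2 * ∫ ω, a j ω ^ 2 ∂stdPrior ι := by
  have h := sqIntegrableOn_add_sum_eval_mul hk hkS
    (SqIntegrableOn.sum Finset.univ fun j => (ha j).const_mul (m j))
    (fun j => (ha j).const_mul (d j)) Finset.univ
  have e : ∀ ω : ι → ℝ, ∑ j, m j * a j ω + ∑ j, ω (k j) * (d j * a j ω)
      = ∑ j, (m j + d j * ω (k j)) * a j ω := fun ω => by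
    rw [← Finset.sum_add_distrib]
    exact Finset.sum_congr rfl fun j _ => by ring
  simp only [e, mul_pow, integral_const_mul, Finset.coe_univ, Set.image_univ] at h
  exact h

lemma integral_sq_add_le {S : Set ι} {g h : (ι → ℝ) → ℝ} (hg : SqIntegrableOn S g)
    (hh : SqIntegrableOn S h) :
    ∫ ω, (g ω + h ω) ^ 2 ∂stdPrior ι
      ≤ 2 * ∫ ω, g ω ^ 2 ∂stdPrior ι + 2 * ∫ ω, h ω ^ 2 ∂stdPrior ι := by
  rw [← integral_const_mul, ← integral_const_mul,
    ← integral_add (hg.integrable_sq.const_mul 2) (hh.integrable_sq.const_mul 2)]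
  refine integral_mono (hg.add hh).integrable_sq
    ((hg.integrable_sq.const_mul 2).add (hh.integrable_sq.const_mul 2)) fun ω => ?_
  show (g ω + h ω) ^ 2 ≤ 2 * g ω ^ 2 + 2 * h ω ^ 2
  nlinarith [sq_nonneg (g ω - h ω)]

lemma integral_sum_mul_sq_le {S : Set ι} {J : Type} [Fintype J] (m : J → ℝ)
    {a : J → (ι → ℝ) → ℝ} (ha : ∀ j, SqIntegrableOn S (a j)) :
    ∫ ω, (∑ j, m j * a j ω) ^ 2 ∂stdPrior ι
      ≤ (∑ j, m j ^ 2) * ∑ j, ∫ ω, a j ω ^ 2 ∂stdPrior ι := by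
  rw [← integral_finsetSum _ fun j _ => (ha j).integrable_sq, ← integral_const_mul]
  exact integral_mono (SqIntegrableOn.sum Finset.univ fun j => (ha j).const_mul (m j)).integrable_sq
    ((integrable_finsetSum _ fun j _ => (ha j).integrable_sq).const_mul _)
    fun ω => Finset.sum_mul_sq_le_sq_mul_sq _ _ _

/-- Coupling estimate for one affine unit: perturbed parameters `m j + d j * ω (k j)` acting on `a`
against standard parameters acting on `b`. -/
lemma integral_affine_sub_sq_le {S : Set ι} {J : Type} [Fintype J] {k : J → ι}
    (hk : Function.Injective k) (hkS : ∀ j, k j ∉ S) (m d : J → ℝ) {a b : J → (ι → ℝ) → ℝ}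
    (ha : ∀ j, SqIntegrableOn S (a j)) (hb : ∀ j, SqIntegrableOn S (b j)) :
    ∫ ω, (∑ j, (m j + d j * ω (k j)) * a j ω - ∑ j, ω (k j) * b j ω) ^ 2 ∂stdPrior ι
      ≤ 2 * ∑ j, ∫ ω, (a j ω - b j ω) ^ 2 ∂stdPrior ι
        + 2 * (∑ j, (m j ^ 2 + (d j - 1) ^ 2)) * ∑ j, ∫ ω, a j ω ^ 2 ∂stdPrior ι := by
  -- Both sums share the same $\omega$, so the difference has constant part $\sum_j m_ja_j$ and the
  -- coefficient of $\omega_{k_j}$ is $(a_j-b_j)+(d_j-1)a_j$.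
  have h := (sqIntegrableOn_add_sum_eval_mul hk hkS
    (SqIntegrableOn.sum Finset.univ fun j => (ha j).const_mul (m j))
    (fun j => (((ha j).sub (hb j)).add ((ha j).const_mul (d j - 1)))) Finset.univ).2
  have e : ∀ ω : ι → ℝ, ∑ j, m j * a j ω
      + ∑ j, ω (k j) * ((a j ω - b j ω) + (d j - 1) * a j ω)
      = ∑ j, (m j + d j * ω (k j)) * a j ω - ∑ j, ω (k j) * b j ω := fun ω => by
    rw [← Finset.sum_add_distrib, ← Finset.sum_sub_distrib]
    exact Finset.sum_congr rfl fun j _ => by ring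
  simp only [e] at h
  rw [h]
  have hA : ∀ j, 0 ≤ ∫ ω, a j ω ^ 2 ∂stdPrior ι := fun j => integral_nonneg fun ω => sq_nonneg _
  have h1 := integral_sum_mul_sq_le m ha
  have h2 : ∑ j, ∫ ω, ((a j ω - b j ω) + (d j - 1) * a j ω) ^ 2 ∂stdPrior ι
      ≤ ∑ j, (2 * ∫ ω, (a j ω - b j ω) ^ 2 ∂stdPrior ι
        + 2 * ((d j - 1) ^ 2 * ∫ ω, a j ω ^ 2 ∂stdPrior ι)) :=
    Finset.sum_le_sum fun j _ => by
      have := integral_sq_add_le ((ha j).sub (hb j)) ((ha j).const_mul (d j - 1))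
      simpa only [mul_pow, integral_const_mul] using this
  rw [Finset.sum_add_distrib, ← Finset.mul_sum, ← Finset.mul_sum] at h2
  have h3 : ∑ j, (d j - 1) ^ 2 * ∫ ω, a j ω ^ 2 ∂stdPrior ι
      ≤ (∑ j, (d j - 1) ^ 2) * ∑ j, ∫ ω, a j ω ^ 2 ∂stdPrior ι := by
    rw [Finset.mul_sum]
    refine Finset.sum_le_sum fun j _ => mul_le_mul_of_nonneg_right ?_ (hA j)
    exact Finset.single_le_sum (f := fun j => (d j - 1) ^ 2) (fun _ _ => sq_nonneg _)
      (Finset.mem_univ j)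
  have h4 : 0 ≤ (∑ j, m j ^ 2) * ∑ j, ∫ ω, a j ω ^ 2 ∂stdPrior ι :=
    mul_nonneg (Finset.sum_nonneg fun _ _ => sq_nonneg _) (Finset.sum_nonneg fun j _ => hA j)
  rw [Finset.sum_add_distrib]
  linarith

/-- Restricts the global parameter budget to the parameters of one layer or one unit. -/
lemma sum_comp_le_sum_of_injective {κ : Type} [Fintype κ] {e : κ → ι}
    (he : Function.Injective e) {f : ι → ℝ} (hf : ∀ i, 0 ≤ f i) : ∑ a, f (e a) ≤ ∑ i, f i := by
  classical
  rw [← Finset.sum_image (s := Finset.univ) (g := e) (f := f) (fun _ _ _ _ h => he h)]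
  exact Finset.sum_le_sum_of_subset_of_nonneg (Finset.subset_univ _) fun i _ _ => hf i

end Innovation

/-! ### Consequences of the Lipschitz and even-part assumptions -/

section Activation

variable {φ : ℝ → ℝ} {α : ℝ}

/-- Constancy of the even part enters the argument only as oddness of $\phi-\alpha$. -/
lemma activation_neg_sub (hα : ∀ a, evenPart φ a = α) (a : ℝ) : φ (-a) - α = -(φ a - α) := by
  have := hα a
  unfold evenPart at this
  linarith

lemma activation_sub_sq_le (hφ : LipschitzWith 1 φ) (a b : ℝ) : (φ a - φ b) ^ 2 ≤ (a - b) ^ 2 := by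
  have h := hφ.dist_le_mul a b
  simp only [NNReal.coe_one, one_mul, Real.dist_eq] at h
  exact sq_le_sq.2 h

lemma activation_centered_sq_le (hφ : LipschitzWith 1 φ) (hα : ∀ a, evenPart φ a = α) (a : ℝ) :
    (φ a - α) ^ 2 ≤ a ^ 2 := by
  have h0 : φ 0 = α := by
    have := activation_neg_sub hα 0
    rw [neg_zero] at this
    linarith
  simpa [h0] using activation_sub_sq_le hφ a 0

lemma activation_sq_le (hφ : LipschitzWith 1 φ) (hα : ∀ a, evenPart φ a = α) (a : ℝ) :
    φ a ^ 2 ≤ 2 * α ^ 2 + 2 * a ^ 2 := by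
  have := activation_centered_sq_le hφ hα a
  nlinarith [sq_nonneg (φ a - α - α)]

end Activation

/-! ### Layerwise recursion for prior moments and for the coupling distance -/

section Layers

variable {Di Do M L : ℕ}

/-- Index of the layer a parameter feeds into; the output layer has index `L`. -/
def ParamIdx.layer : ParamIdx Di Do M L → ℕ
  | .inWeight _ _ => 0
  | .inBias _ => 0
  | .hidWeight l _ _ => l + 1
  | .hidBias l _ => l + 1
  | .outWeight _ _ => L
  | .outBias _ => L

/-- The parameters of the hidden layers with index at most `l`. -/
def layersUpTo (Di Do M L l : ℕ) : Set (ParamIdx Di Do M L) := {k | k.layer ≤ l}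

/-- The parameters `μ + σ ω` obtained from standardized ones. -/
def reparam {ι : Type} (μ σ : ι → ℝ) (ω : ι → ℝ) : ι → ℝ := fun k => μ k + σ k * ω k

lemma reparam_zero_one {ι : Type} (ω : ι → ℝ) : reparam (fun _ => 0) (fun _ => 1) ω = ω := by
  ext k
  simp [reparam]

/-- The parameters of unit `i` in the first hidden layer; `none` stands for the bias. -/
def inIdx (i : Fin M) : Option (Fin Di) → ParamIdx Di Do M L
  | none => .inBias i
  | some j => .inWeight i j

/-- The quantities multiplied by the parameters `inIdx`. -/
noncomputable def inFeature (x : EuclideanSpace ℝ (Fin Di)) : Option (Fin Di) → ℝ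
  | none => 1
  | some j => 1 / √(Di : ℝ) * x j

/-- The parameters of unit `i` in hidden layer `l + 1`; `none` stands for the bias. -/
def hidIdx (l : Fin (L - 1)) (i : Fin M) : Option (Fin M) → ParamIdx Di Do M L
  | none => .hidBias l i
  | some j => .hidWeight l i j

/-- The quantities multiplied by the parameters `hidIdx`. -/
noncomputable def hidFeature (φ : ℝ → ℝ) (x : EuclideanSpace ℝ (Fin Di)) (l : ℕ) (h : l < L)
    (θ : Params Di Do M L) : Option (Fin M) → ℝ
  | none => 1
  | some j => 1 / √(M : ℝ) * φ (preact φ θ x l h j)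

lemma inIdx_injective :
    Function.Injective fun p : Fin M × Option (Fin Di) => inIdx (Do := Do) (L := L) p.1 p.2 := by
  rintro ⟨i, _ | j⟩ ⟨i', _ | j'⟩ h <;> simp_all [inIdx]

lemma hidIdx_injective (l : Fin (L - 1)) :
    Function.Injective fun p : Fin M × Option (Fin M) =>
      hidIdx (Di := Di) (Do := Do) l p.1 p.2 := by
  rintro ⟨i, _ | j⟩ ⟨i', _ | j'⟩ h <;> simp_all [hidIdx]

lemma inIdx_injective_right (i : Fin M) :
    Function.Injective (inIdx (Di := Di) (Do := Do) (L := L) i) :=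
  fun a b h => (Prod.ext_iff.1 (inIdx_injective (a₁ := (i, a)) (a₂ := (i, b)) h)).2

lemma hidIdx_injective_right (l : Fin (L - 1)) (i : Fin M) :
    Function.Injective (hidIdx (Di := Di) (Do := Do) l i) :=
  fun a b h => (Prod.ext_iff.1 (hidIdx_injective l (a₁ := (i, a)) (a₂ := (i, b)) h)).2

lemma layer_inIdx (i : Fin M) (o : Option (Fin Di)) :
    (inIdx (Do := Do) (L := L) i o).layer = 0 := by
  cases o <;> rfl

lemma layer_hidIdx (l : Fin (L - 1)) (i : Fin M) (o : Option (Fin M)) :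
    (hidIdx (Di := Di) (Do := Do) l i o).layer = l + 1 := by
  cases o <;> rfl

lemma hidIdx_notMem (l : ℕ) (hl : l < L - 1) (i : Fin M) (o : Option (Fin M)) :
    hidIdx ⟨l, hl⟩ i o ∉ layersUpTo Di Do M L l := by
  simp [layersUpTo, layer_hidIdx]

lemma preact_zero_eq (φ : ℝ → ℝ) (θ : Params Di Do M L) (x : EuclideanSpace ℝ (Fin Di))
    (h : 0 < L) (i : Fin M) : preact φ θ x 0 h i = ∑ o, θ (inIdx i o) * inFeature x o := by
  simp only [preact, Fintype.sum_option, inIdx, inFeature, Finset.mul_sum]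
  rw [add_comm, mul_one]
  congr 1
  exact Finset.sum_congr rfl fun j _ => by ring

lemma preact_succ_eq (φ : ℝ → ℝ) (θ : Params Di Do M L) (x : EuclideanSpace ℝ (Fin Di))
    (l : ℕ) (h : l + 1 < L) (i : Fin M) : preact φ θ x (l + 1) h i
      = ∑ o, θ (hidIdx ⟨l, by omega⟩ i o) * hidFeature φ x l (by omega) θ o := by
  simp only [preact, Fintype.sum_option, hidIdx, hidFeature, Finset.mul_sum]
  rw [add_comm, mul_one]
  congr 1
  exact Finset.sum_congr rfl fun j _ => by ring

lemma preact_dependsOn (φ : ℝ → ℝ) (x : EuclideanSpace ℝ (Fin Di)) (l : ℕ) (h : l < L)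
    (i : Fin M) :
    DependsOn (fun θ : Params Di Do M L => preact φ θ x l h i) (layersUpTo Di Do M L l) := by
  induction l generalizing i with
  | zero =>
    intro θ θ' e
    simp only [preact_zero_eq]
    exact Finset.sum_congr rfl fun o _ => by rw [e _ (layer_inIdx i o).le]
  | succ l ih =>
    intro θ θ' e
    simp only [preact_succ_eq]
    refine Finset.sum_congr rfl fun o _ => ?_
    rw [e _ (layer_hidIdx _ i o).le]
    cases o with
    | none => rfl
    | some j =>
      have := ih (by omega) j (x := θ) (y := θ') fun k hk => e k (Nat.le_succ_of_le hk)
      simp only at this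
      simp only [hidFeature, this]

variable (φ : ℝ → ℝ) (x : EuclideanSpace ℝ (Fin Di))

lemma hidFeature_sqIntegrableOn (hφ : LipschitzWith 1 φ) (μ σ : ParamIdx Di Do M L → ℝ)
    {S : Set (ParamIdx Di Do M L)} (l : ℕ) (h : l < L)
    (hz : ∀ i, SqIntegrableOn S (fun ω => preact φ (reparam μ σ ω) x l h i))
    (o : Option (Fin M)) :
    SqIntegrableOn S (fun ω => hidFeature φ x l h (reparam μ σ ω) o) := by
  cases o with
  | none => exact SqIntegrableOn.const 1
  | some j => exact ((hz j).lipschitz_comp hφ).const_mul _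

lemma preact_sqIntegrableOn (hφ : LipschitzWith 1 φ) (μ σ : ParamIdx Di Do M L → ℝ) (l : ℕ)
    (h : l < L) (i : Fin M) :
    SqIntegrableOn (layersUpTo Di Do M L l) (fun ω => preact φ (reparam μ σ ω) x l h i) := by
  induction l generalizing i with
  | zero =>
    simp only [preact_zero_eq, reparam]
    refine (integral_sum_affine_eval_mul_sq (S := ∅) (inIdx_injective_right i) (fun _ h => h)
      (fun o => μ (inIdx i o)) (fun o => σ (inIdx i o))
      (fun o => SqIntegrableOn.const (inFeature x o))).1.mono ?_
    rw [Set.empty_union]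
    rintro _ ⟨o, rfl⟩
    exact (layer_inIdx i o).le
  | succ l ih =>
    simp only [preact_succ_eq]
    refine (integral_sum_affine_eval_mul_sq (hidIdx_injective_right ⟨l, by omega⟩ i)
      (hidIdx_notMem l (by omega) i)
      (fun o => μ (hidIdx _ i o)) (fun o => σ (hidIdx _ i o))
      (hidFeature_sqIntegrableOn φ x hφ μ σ l (by omega) (ih (by omega)))).1.mono ?_
    rintro _ (hk | ⟨o, rfl⟩)
    · exact Nat.le_succ_of_le hk
    · exact (layer_hidIdx _ i o).le

lemma preact_sqIntegrableOn_std (hφ : LipschitzWith 1 φ) (l : ℕ) (h : l < L) (i : Fin M) :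
    SqIntegrableOn (layersUpTo Di Do M L l) (fun ω => preact φ ω x l h i) := by
  simpa only [reparam_zero_one] using
    preact_sqIntegrableOn (Do := Do) φ x hφ (fun _ => 0) (fun _ => 1) l h i

lemma hidFeature_sqIntegrableOn_std (hφ : LipschitzWith 1 φ) (l : ℕ) (h : l < L)
    (o : Option (Fin M)) :
    SqIntegrableOn (layersUpTo Di Do M L l) (fun ω => hidFeature φ x l h ω o) := by
  simpa only [reparam_zero_one] using
    hidFeature_sqIntegrableOn (Do := Do) φ x hφ (fun _ => 0) (fun _ => 1) l h
      (preact_sqIntegrableOn φ x hφ _ _ l h) o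

lemma sum_inFeature_sq : ∑ o, inFeature x o ^ 2 = 1 + 1 / (Di : ℝ) * ‖x‖ ^ 2 := by
  simp only [Fintype.sum_option, inFeature, mul_pow, one_pow, div_pow,
    Real.sq_sqrt (Nat.cast_nonneg Di), ← Finset.mul_sum]
  rw [EuclideanSpace.norm_sq_eq]
  simp

/-- Size of the input together with the constants of the network. -/
noncomputable def inputScale (α : ℝ) (x : EuclideanSpace ℝ (Fin Di)) : ℝ :=
  α ^ 2 + 1 + 1 / (Di : ℝ) * ‖x‖ ^ 2

lemma one_add_sq_le_inputScale (α : ℝ) : α ^ 2 + 1 ≤ inputScale α x := by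
  have : 0 ≤ 1 / (Di : ℝ) * ‖x‖ ^ 2 := by positivity
  unfold inputScale
  linarith

lemma inputScale_pos (α : ℝ) : 0 < inputScale α x := by
  have := one_add_sq_le_inputScale x α
  have := sq_nonneg α
  linarith

variable {α : ℝ}

lemma integral_activation_sq_le {ι : Type} [Fintype ι] {S : Set ι} {g : (ι → ℝ) → ℝ}
    (hg : SqIntegrableOn S g) (hφ : LipschitzWith 1 φ) (hα : ∀ a, evenPart φ a = α) :
    ∫ ω, φ (g ω) ^ 2 ∂stdPrior ι ≤ 2 * α ^ 2 + 2 * ∫ ω, g ω ^ 2 ∂stdPrior ι := by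
  have i1 := hg.integrable_sq.const_mul 2
  calc _ ≤ ∫ ω, (2 * α ^ 2 + 2 * g ω ^ 2) ∂stdPrior ι :=
        integral_mono (hg.lipschitz_comp hφ).integrable_sq ((integrable_const _).add i1)
          fun ω => activation_sq_le hφ hα _
    _ = _ := by
        rw [integral_add (integrable_const _) i1, integral_const, probReal_univ, one_smul,
          integral_const_mul]

lemma integral_hidFeature_sq (θ : Params Di Do M L → Params Di Do M L) (l : ℕ) (h : l < L) :
    ∑ o, ∫ ω, hidFeature φ x l h (θ ω) o ^ 2 ∂stdPrior (ParamIdx Di Do M L)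
      = 1 + 1 / (M : ℝ) * ∑ j, ∫ ω, φ (preact φ (θ ω) x l h j) ^ 2
        ∂stdPrior (ParamIdx Di Do M L) := by
  simp only [Fintype.sum_option, hidFeature, one_pow, integral_const, probReal_univ, smul_eq_mul,
    mul_one, mul_pow, integral_const_mul, div_pow, Real.sq_sqrt (Nat.cast_nonneg M),
    ← Finset.mul_sum]

/-- Second moments of the preactivations under the prior. -/
lemma integral_preact_sq_le (hM : 1 ≤ M) (hφ : LipschitzWith 1 φ) (hα : ∀ a, evenPart φ a = α)
    (l : ℕ) (h : l < L) (i : Fin M) :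
    ∫ ω, preact φ ω x l h i ^ 2 ∂stdPrior (ParamIdx Di Do M L)
      ≤ 3 ^ (l + 1) * inputScale α x := by
  have hX := one_add_sq_le_inputScale x α
  have hM' : (0 : ℝ) < M := by exact_mod_cast hM
  induction l generalizing i with
  | zero =>
    have e := (integral_sum_affine_eval_mul_sq (S := ∅)
      (inIdx_injective_right (Do := Do) (L := L) i) (fun _ h => h) (fun _ => 0) (fun _ => 1)
      (fun o => SqIntegrableOn.const (inFeature x o))).2
    simp only [zero_add, one_mul, zero_mul, Finset.sum_const_zero, one_pow, integral_const,
      probReal_univ, smul_eq_mul, ne_eq, OfNat.ofNat_ne_zero, not_false_eq_true, zero_pow,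
      mul_zero, sum_inFeature_sq] at e
    simp only [preact_zero_eq, e]
    have h1 : 1 + 1 / (Di : ℝ) * ‖x‖ ^ 2 ≤ inputScale α x := by
      unfold inputScale
      nlinarith [sq_nonneg α]
    have := inputScale_pos x α
    linarith
  | succ l ih =>
    have hl : l < L := by omega
    have hF := hidFeature_sqIntegrableOn_std (Do := Do) (M := M) φ x hφ l hl
    have e := (integral_sum_affine_eval_mul_sq (hidIdx_injective_right ⟨l, by omega⟩ i)
      (hidIdx_notMem l (by omega) i) (fun _ => 0) (fun _ => 1) hF).2
    simp only [zero_add, one_mul, zero_mul, Finset.sum_const_zero, one_pow, ne_eq,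
      OfNat.ofNat_ne_zero, not_false_eq_true, zero_pow, integral_zero] at e
    simp only [preact_succ_eq, e]
    have hz := fun j => preact_sqIntegrableOn_std (Do := Do) (M := M) φ x hφ l hl j
    have e2 := integral_hidFeature_sq (Do := Do) (M := M) φ x id l hl
    simp only [id_eq] at e2
    rw [e2]
    calc _ ≤ 1 + 1 / (M : ℝ) * ∑ j, (2 * α ^ 2
          + 2 * ∫ ω, preact φ ω x l hl j ^ 2 ∂stdPrior (ParamIdx Di Do M L)) := by
          gcongr with j
          exact integral_activation_sq_le φ (hz j) hφ hα
      _ ≤ 1 + 1 / (M : ℝ) * ∑ _j : Fin M, (2 * α ^ 2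
          + 2 * (3 ^ (l + 1) * inputScale α x)) := by
          gcongr with j
          exact ih hl j
      _ = 1 + 2 * α ^ 2 + 2 * (3 ^ (l + 1) * inputScale α x) := by
          simp only [Finset.sum_const, Finset.card_univ, Fintype.card_fin, nsmul_eq_mul]
          field_simp
          ring
      _ ≤ 3 ^ (l + 1 + 1) * inputScale α x := by
          -- The term $1+2\alpha^2\le 3X$, with $X$ the input scale, is absorbed into the third copy
          -- of $3^{l+1}X$.
          have h3 : (3 : ℝ) ≤ 3 ^ (l + 1) := by
            simpa using pow_le_pow_right₀ (by norm_num : (1 : ℝ) ≤ 3) (Nat.le_add_left 1 l)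
          have hp := inputScale_pos x α
          rw [pow_succ _ (l + 1)]
          nlinarith [sq_nonneg α]

/-- The squared distance between the preactivations under the coupling `ω ↦ μ + σ ω`. -/
noncomputable def couplingDist (μ σ : ParamIdx Di Do M L → ℝ) (l : ℕ) (h : l < L) : ℝ :=
  ∑ i, ∫ ω, (preact φ (reparam μ σ ω) x l h i - preact φ ω x l h i) ^ 2
    ∂stdPrior (ParamIdx Di Do M L)

/-- The constant bias feature cancels and $\phi$ is 1-Lipschitz. The factor $1/M$ is kept because it
offsets the $M$ units of the next layer. -/
lemma integral_hidFeature_sub_sq_le (hM : 1 ≤ M) (hφ : LipschitzWith 1 φ)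
    (μ σ : ParamIdx Di Do M L → ℝ) (l : ℕ) (h : l < L) :
    ∑ o, ∫ ω, (hidFeature φ x l h (reparam μ σ ω) o - hidFeature φ x l h ω o) ^ 2
      ∂stdPrior (ParamIdx Di Do M L) ≤ 1 / (M : ℝ) * couplingDist φ x μ σ l h := by
  have hz := preact_sqIntegrableOn φ x hφ μ σ l h
  have hz' := preact_sqIntegrableOn_std (Do := Do) (M := M) φ x hφ l h
  simp only [Fintype.sum_option, hidFeature, sub_self, ne_eq, OfNat.ofNat_ne_zero,
    not_false_eq_true, zero_pow, integral_zero, zero_add, couplingDist, Finset.mul_sum]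
  refine Finset.sum_le_sum fun j _ => ?_
  simp only [← mul_sub, mul_pow, integral_const_mul, div_pow, one_pow,
    Real.sq_sqrt (Nat.cast_nonneg M)]
  refine mul_le_mul_of_nonneg_left ?_ (by positivity)
  exact integral_mono (((hz j).lipschitz_comp hφ).sub ((hz' j).lipschitz_comp hφ)).integrable_sq
    ((hz j).sub (hz' j)).integrable_sq fun ω => activation_sub_sq_le hφ _ _

/-- Posterior activations are prior activations plus a difference controlled by the coupling. The
factor $1/M$ before the distance is discarded here. -/
lemma integral_hidFeature_sq_le (hM : 1 ≤ M) (hφ : LipschitzWith 1 φ)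
    (hα : ∀ a, evenPart φ a = α) (μ σ : ParamIdx Di Do M L → ℝ) (l : ℕ) (h : l < L) :
    ∑ o, ∫ ω, hidFeature φ x l h (reparam μ σ ω) o ^ 2 ∂stdPrior (ParamIdx Di Do M L)
      ≤ 1 + 4 * α ^ 2 + 4 * (3 ^ (l + 1) * inputScale α x)
        + 2 * couplingDist φ x μ σ l h := by
  have hz := preact_sqIntegrableOn φ x hφ μ σ l h
  have hz' := preact_sqIntegrableOn_std (Do := Do) (M := M) φ x hφ l h
  have hM' : (0 : ℝ) < M := by exact_mod_cast hM
  have hM1 : (1 : ℝ) ≤ M := by exact_mod_cast hM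
  have hD : 0 ≤ couplingDist φ x μ σ l h :=
    Finset.sum_nonneg fun _ _ => integral_nonneg fun _ => sq_nonneg _
  rw [integral_hidFeature_sq]
  have key : ∀ j, ∫ ω, φ (preact φ (reparam μ σ ω) x l h j) ^ 2 ∂stdPrior (ParamIdx Di Do M L)
      ≤ (4 * α ^ 2 + 4 * (3 ^ (l + 1) * inputScale α x))
        + 2 * ∫ ω, (preact φ (reparam μ σ ω) x l h j - preact φ ω x l h j) ^ 2
          ∂stdPrior (ParamIdx Di Do M L) := by
    intro j
    have hP := integral_preact_sq_le (Do := Do) φ x hM hφ hα l h j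
    have h1 := integral_activation_sq_le φ (hz' j) hφ hα
    have hd := ((hz j).lipschitz_comp hφ).sub ((hz' j).lipschitz_comp hφ)
    have h2 := integral_sq_add_le ((hz' j).lipschitz_comp hφ) hd
    simp only [add_sub_cancel] at h2
    have h3 := integral_mono hd.integrable_sq ((hz j).sub (hz' j)).integrable_sq
      fun ω => activation_sub_sq_le hφ _ _
    linarith
  have hs := Finset.sum_le_sum fun j (_ : j ∈ Finset.univ) => key j
  rw [Finset.sum_add_distrib, ← Finset.mul_sum] at hs
  simp only [Finset.sum_const, Finset.card_univ, Fintype.card_fin, nsmul_eq_mul] at hs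
  change _ ≤ _ + 2 * couplingDist φ x μ σ l h at hs
  have h1 := mul_le_mul_of_nonneg_left hs (by positivity : 0 ≤ 1 / (M : ℝ))
  have h2 : 1 / (M : ℝ) * (M * (4 * α ^ 2 + 4 * (3 ^ (l + 1) * inputScale α x))
      + 2 * couplingDist φ x μ σ l h) = 4 * α ^ 2 + 4 * (3 ^ (l + 1) * inputScale α x)
      + 1 / M * (2 * couplingDist φ x μ σ l h) := by
    field_simp
  have h3 : 1 / (M : ℝ) * (2 * couplingDist φ x μ σ l h) ≤ 1 * (2 * couplingDist φ x μ σ l h) :=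
    mul_le_mul_of_nonneg_right ((div_le_one hM').2 hM1) (by linarith)
  linarith

/-- The coupled preactivations stay close, uniformly in the width. -/
lemma couplingDist_le (hM : 1 ≤ M) (hφ : LipschitzWith 1 φ) (hα : ∀ a, evenPart φ a = α)
    (μ σ : ParamIdx Di Do M L → ℝ) {K κ : ℝ} (hK : ∑ k, (μ k ^ 2 + (σ k - 1) ^ 2) ≤ K)
    (hκ : 1 ≤ κ) (hKκ : K ≤ κ) (l : ℕ) (h : l < L) :
    couplingDist φ x μ σ l h ≤ K * inputScale α x * κ ^ l * 10 ^ (l + 1) := by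
  have hX := one_add_sq_le_inputScale x α
  have hX0 := inputScale_pos x α
  have hM' : (0 : ℝ) < M := by exact_mod_cast hM
  have hnn : ∀ k, 0 ≤ μ k ^ 2 + (σ k - 1) ^ 2 := fun k => by positivity
  have hK0 : 0 ≤ K := (Finset.sum_nonneg fun k _ => hnn k).trans hK
  induction l with
  | zero =>
    have h1 : ∀ i : Fin M, _ := fun i => integral_affine_sub_sq_le (S := ∅)
      (inIdx_injective_right (Do := Do) (L := L) i) (fun _ h => h)
      (fun o => μ (inIdx i o)) (fun o => σ (inIdx i o))
      (fun o => SqIntegrableOn.const (inFeature x o)) (fun o => SqIntegrableOn.const (inFeature x o))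
    simp only [sub_self, ne_eq, OfNat.ofNat_ne_zero, not_false_eq_true, zero_pow, integral_const,
      Finset.sum_const_zero, mul_zero, zero_add, probReal_univ, smul_eq_mul, one_mul,
      sum_inFeature_sq] at h1
    have h2 := Finset.sum_le_sum fun i (_ : i ∈ Finset.univ) => h1 i
    rw [← Finset.sum_mul, ← Finset.mul_sum, ← Fintype.sum_prod_type'] at h2
    have h3 := (sum_comp_le_sum_of_injective (inIdx_injective (Do := Do) (L := L)) hnn).trans hK
    have h4 : couplingDist φ x μ σ 0 h ≤ 2 * K * (1 + 1 / (Di : ℝ) * ‖x‖ ^ 2) := by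
      simp only [couplingDist, preact_zero_eq, reparam]
      refine h2.trans (mul_le_mul_of_nonneg_right ?_ (by positivity))
      linarith
    have h5 : 1 + 1 / (Di : ℝ) * ‖x‖ ^ 2 ≤ inputScale α x := by
      unfold inputScale
      nlinarith [sq_nonneg α]
    have h6 := mul_le_mul_of_nonneg_left h5 hK0
    have h7 := mul_nonneg hK0 hX0.le
    simp only [pow_zero, zero_add, pow_one, mul_one]
    linarith
  | succ l ih =>
    have hl : l < L := by omega
    have hD := ih hl
    have hD0 : 0 ≤ couplingDist φ x μ σ l hl :=
      Finset.sum_nonneg fun _ _ => integral_nonneg fun _ => sq_nonneg _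
    have h1 : ∀ i : Fin M, _ := fun i => integral_affine_sub_sq_le
      (hidIdx_injective_right (Di := Di) (Do := Do) ⟨l, by omega⟩ i)
      (hidIdx_notMem l (by omega) i)
      (fun o => μ (hidIdx ⟨l, by omega⟩ i o)) (fun o => σ (hidIdx ⟨l, by omega⟩ i o))
      (hidFeature_sqIntegrableOn φ x hφ μ σ l hl (preact_sqIntegrableOn φ x hφ μ σ l hl))
      (hidFeature_sqIntegrableOn_std φ x hφ l hl)
    have hf := integral_hidFeature_sub_sq_le φ x hM hφ μ σ l hl
    have hF := integral_hidFeature_sq_le φ x hM hφ hα μ σ l hl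
    set f := ∑ o, ∫ ω, (hidFeature φ x l hl (reparam μ σ ω) o - hidFeature φ x l hl ω o) ^ 2
      ∂stdPrior (ParamIdx Di Do M L)
    set F := ∑ o, ∫ ω, hidFeature φ x l hl (reparam μ σ ω) o ^ 2 ∂stdPrior (ParamIdx Di Do M L)
    have hF0 : 0 ≤ F := Finset.sum_nonneg fun _ _ => integral_nonneg fun _ => sq_nonneg _
    have h2 := Finset.sum_le_sum fun i (_ : i ∈ Finset.univ) => h1 i
    rw [Finset.sum_add_distrib, Finset.sum_const, ← Finset.sum_mul, ← Finset.mul_sum,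
      ← Fintype.sum_prod_type'] at h2
    -- The budgets of all units of the layer together stay below $K$, so summing over units produces
    -- no factor $M$.
    have h3 := (sum_comp_le_sum_of_injective
      (hidIdx_injective (Di := Di) (Do := Do) (M := M) ⟨l, by omega⟩) hnn).trans hK
    simp only [Finset.card_univ, Fintype.card_fin, nsmul_eq_mul] at h2
    have h4 : (M : ℝ) * (2 * f) ≤ 2 * couplingDist φ x μ σ l hl := by
      have := mul_le_mul_of_nonneg_left hf hM'.le
      rw [← mul_assoc, mul_one_div_cancel hM'.ne', one_mul] at this
      linarith
    have h5 : couplingDist φ x μ σ (l + 1) h ≤ 2 * couplingDist φ x μ σ l hl + 2 * K * F := by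
      simp only [couplingDist, preact_succ_eq]
      refine h2.trans (add_le_add h4 (mul_le_mul_of_nonneg_right ?_ hF0))
      linarith
    have h6 : F ≤ 4 * inputScale α x + 4 * (3 ^ (l + 1) * inputScale α x)
        + 2 * couplingDist φ x μ σ l hl := by linarith
    have h7 := mul_le_mul_of_nonneg_left h6 hK0
    have h8 := mul_le_mul_of_nonneg_right hKκ hD0
    have h9 := mul_le_mul_of_nonneg_right hκ hD0
    have h10 := mul_le_mul_of_nonneg_left hD (by linarith : 0 ≤ κ)
    have hκl : 1 ≤ κ ^ (l + 1) := one_le_pow₀ hκ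
    -- The recursion multiplies the previous bound by at most $6\kappa$; the inhomogeneous term is
    -- at most $4\kappa$ times that bound, hence base $10=6+4$.
    have hpow : (8 : ℝ) + 8 * 3 ^ (l + 1) ≤ 4 * 10 ^ (l + 1) := by
      have a1 : (3 : ℝ) ^ l ≤ 10 ^ l := by gcongr; norm_num
      have a2 : (1 : ℝ) ≤ 3 ^ l := one_le_pow₀ (by norm_num)
      rw [pow_succ, pow_succ]
      linarith
    have hKX : 0 ≤ K * inputScale α x := by positivity
    have h11 : K * inputScale α x * (8 + 8 * 3 ^ (l + 1))
        ≤ K * inputScale α x * (κ ^ (l + 1) * (4 * 10 ^ (l + 1))) := by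
      refine mul_le_mul_of_nonneg_left ?_ hKX
      refine hpow.trans ?_
      have : (0 : ℝ) ≤ 4 * 10 ^ (l + 1) := by positivity
      nlinarith
    calc couplingDist φ x μ σ (l + 1) h
        ≤ 6 * (κ * couplingDist φ x μ σ l hl)
          + K * inputScale α x * (8 + 8 * 3 ^ (l + 1)) := by linarith
      _ ≤ 6 * (κ * (K * inputScale α x * κ ^ l * 10 ^ (l + 1)))
          + K * inputScale α x * (κ ^ (l + 1) * (4 * 10 ^ (l + 1))) := by linarith
      _ = _ := by ring

end Layers

/-! ### Orthogonality of centred activations by sign symmetry -/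

section Orthogonality

variable {Di Do M L : ℕ}

/-- The sign `-1` on the parameters of unit `i` of hidden layer `l`, and `1` elsewhere. -/
def rowSign (l : ℕ) (i : Fin M) : ParamIdx Di Do M L → ℝ
  | .inWeight i' _ => if l = 0 ∧ i' = i then -1 else 1
  | .inBias i' => if l = 0 ∧ i' = i then -1 else 1
  | .hidWeight l' i' _ => if l = l' + 1 ∧ i' = i then -1 else 1
  | .hidBias l' i' => if l = l' + 1 ∧ i' = i then -1 else 1
  | .outWeight _ _ => 1
  | .outBias _ => 1

lemma rowSign_sq (l : ℕ) (i : Fin M) (k : ParamIdx Di Do M L) : rowSign l i k ^ 2 = 1 := by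
  cases k <;> simp [rowSign, ite_pow]

lemma rowSign_inIdx (i i' : Fin M) (o : Option (Fin Di)) :
    rowSign 0 i (inIdx (Do := Do) (L := L) i' o) = if i' = i then -1 else 1 := by
  cases o <;> simp [rowSign, inIdx]

lemma rowSign_hidIdx (l : ℕ) (hl : l < L - 1) (i i' : Fin M) (o : Option (Fin M)) :
    rowSign (l + 1) i (hidIdx (Di := Di) (Do := Do) ⟨l, hl⟩ i' o) = if i' = i then -1 else 1 := by
  cases o <;> simp [rowSign, hidIdx]

lemma rowSign_of_mem {l : ℕ} (i : Fin M) {k : ParamIdx Di Do M L}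
    (hk : k ∈ layersUpTo Di Do M L l) : rowSign (l + 1) i k = 1 := by
  simp only [layersUpTo, Set.mem_ofPred_eq] at hk
  cases k <;> simp only [ParamIdx.layer] at hk <;> simp only [rowSign] <;> try rw [if_neg]
  all_goals omega

/-- Preactivations are linear in the parameters entering their layer, and earlier layers do not see
the flipped ones. -/
lemma preact_rowSign_mul (φ : ℝ → ℝ) (x : EuclideanSpace ℝ (Fin Di)) (l : ℕ) (h : l < L)
    (i i' : Fin M) (θ : Params Di Do M L) :
    preact φ (fun k => rowSign l i k * θ k) x l h i'
      = (if i' = i then -1 else 1) * preact φ θ x l h i' := by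
  cases l with
  | zero =>
    simp only [preact_zero_eq, rowSign_inIdx, Finset.mul_sum, mul_assoc]
  | succ l =>
    simp only [preact_succ_eq, rowSign_hidIdx, Finset.mul_sum, mul_assoc]
    refine Finset.sum_congr rfl fun o _ => ?_
    cases o with
    | none => rfl
    | some j =>
      have hS := preact_dependsOn (Do := Do) (M := M) (L := L) φ x l (by omega) j
      have : preact φ (fun k => rowSign (l + 1) i k * θ k) x l (by omega) j
          = preact φ θ x l (by omega) j :=
        hS fun k hk => by rw [rowSign_of_mem i hk, one_mul]
      simp only [hidFeature, this]

variable {φ : ℝ → ℝ} {α : ℝ} (x : EuclideanSpace ℝ (Fin Di))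

/-- Centered activations of different units are orthogonal under the prior. -/
lemma integral_centered_mul_eq_zero (hφ : Measurable φ) (hα : ∀ a, evenPart φ a = α) (l : ℕ)
    (h : l < L) {i j : Fin M} (hij : i ≠ j)
    (hm : ∀ i, Measurable fun ω : Params Di Do M L => preact φ ω x l h i) :
    ∫ ω, (φ (preact φ ω x l h i) - α) * (φ (preact φ ω x l h j) - α)
      ∂stdPrior (ParamIdx Di Do M L) = 0 := by
  have e := map_sign_stdPrior (rowSign (Di := Di) (Do := Do) (L := L) l i) (rowSign_sq l i)
  have hmeas : Measurable fun ω : Params Di Do M L =>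
      (φ (preact φ ω x l h i) - α) * (φ (preact φ ω x l h j) - α) :=
    ((hφ.comp (hm i)).sub_const α).mul ((hφ.comp (hm j)).sub_const α)
  have h1 : ∫ ω, (φ (preact φ ω x l h i) - α) * (φ (preact φ ω x l h j) - α)
      ∂stdPrior (ParamIdx Di Do M L) = ∫ ω, -((φ (preact φ ω x l h i) - α)
        * (φ (preact φ ω x l h j) - α)) ∂stdPrior (ParamIdx Di Do M L) := by
    conv_lhs => rw [← e]
    rw [integral_map (measurable_pi_lambda _ fun k =>
      (measurable_pi_apply k).const_mul _).aemeasurable hmeas.aestronglyMeasurable]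
    refine integral_congr_ae (Filter.Eventually.of_forall fun ω => ?_)
    simp only [preact_rowSign_mul, if_true, if_neg hij.symm, one_mul,
      activation_neg_sub hα, neg_mul]
  rw [integral_neg] at h1
  linarith

lemma centered_sqIntegrableOn (hφ : LipschitzWith 1 φ) (α : ℝ) (μ σ : ParamIdx Di Do M L → ℝ)
    (l : ℕ) (h : l < L) (j : Fin M) :
    SqIntegrableOn (layersUpTo Di Do M L l)
      (fun ω => φ (preact φ (reparam μ σ ω) x l h j) - α) :=
  ((preact_sqIntegrableOn φ x hφ μ σ l h j).lipschitz_comp hφ).sub (SqIntegrableOn.const α)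

lemma centered_sqIntegrableOn_std (hφ : LipschitzWith 1 φ) (α : ℝ) (l : ℕ) (h : l < L)
    (j : Fin M) :
    SqIntegrableOn (layersUpTo Di Do M L l) (fun ω => φ (preact φ ω x l h j) - α) :=
  ((preact_sqIntegrableOn_std φ x hφ l h j).lipschitz_comp hφ).sub (SqIntegrableOn.const α)

/-- Orthogonality leaves only the diagonal, which saves a factor $M$ over Cauchy–Schwarz in the
bound for the mean output weights. -/
lemma integral_sum_mul_centered_sq (hφ : LipschitzWith 1 φ) (hα : ∀ a, evenPart φ a = α) (l : ℕ)
    (h : l < L) (m : Fin M → ℝ) :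
    ∫ ω, (∑ j, m j * (φ (preact φ ω x l h j) - α)) ^ 2 ∂stdPrior (ParamIdx Di Do M L)
      = ∑ j, m j ^ 2 * ∫ ω, (φ (preact φ ω x l h j) - α) ^ 2
        ∂stdPrior (ParamIdx Di Do M L) := by
  have hc := centered_sqIntegrableOn_std (Do := Do) (M := M) x hφ α l h
  have hm := fun i => (preact_sqIntegrableOn_std (Do := Do) (M := M) φ x hφ l h i).measurable
  have hi : ∀ i j, Integrable (fun ω => m i * (φ (preact φ ω x l h i) - α)
      * (m j * (φ (preact φ ω x l h j) - α))) (stdPrior (ParamIdx Di Do M L)) := fun i j =>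
    ((hc i).const_mul (m i)).integrable_mul ((hc j).const_mul (m j))
  simp only [sq (∑ j, _), Finset.sum_mul_sum]
  rw [integral_finsetSum _ fun i _ => integrable_finsetSum _ fun j _ => hi i j]
  refine Finset.sum_congr rfl fun i _ => ?_
  rw [integral_finsetSum _ fun j _ => hi i j, Finset.sum_eq_single i]
  · rw [← integral_const_mul]
    exact integral_congr_ae (Filter.Eventually.of_forall fun ω => by ring)
  · intro j _ hji
    have h0 := integral_centered_mul_eq_zero (Do := Do) x hφ.continuous.measurable hα l h
      hji.symm hm
    have e : ∀ ω : Params Di Do M L, m i * (φ (preact φ ω x l h i) - α)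
        * (m j * (φ (preact φ ω x l h j) - α)) = m i * m j *
        ((φ (preact φ ω x l h i) - α) * (φ (preact φ ω x l h j) - α)) := fun ω => by ring
    simp only [e, integral_const_mul, h0, mul_zero]
  · simp

end Orthogonality

/-! ### Scalar inequalities for the output layer -/

section Output

/-- Young's inequality on the cross term $2(a-b)b$; the weight $t$ stays free so that it can later
depend on $M$ and $q$. -/
lemma abs_sq_sub_sq_le {t : ℝ} (ht : 0 < t) (a b : ℝ) :
    |a ^ 2 - b ^ 2| ≤ (1 + t) * (a - b) ^ 2 + b ^ 2 / t := by
  have h : 2 * (|a - b| * |b|) ≤ t * (a - b) ^ 2 + b ^ 2 / t := by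
    rw [← sq_abs (a - b), ← sq_abs b, ← sub_nonneg]
    have : t * |a - b| ^ 2 + |b| ^ 2 / t - 2 * (|a - b| * |b|) = (t * |a - b| - |b|) ^ 2 / t := by
      field_simp
      ring
    rw [this]
    positivity
  have e : a ^ 2 - b ^ 2 = (a - b) ^ 2 + 2 * ((a - b) * b) := by ring
  rw [e]
  refine (abs_add_le _ _).trans ?_
  rw [abs_of_nonneg (sq_nonneg (a - b)), abs_mul, abs_two, abs_mul]
  linarith

lemma sum_abs_le_sqrt_mul {M : ℕ} {a : Fin M → ℝ} {q : ℝ} (hq : 0 ≤ q)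
    (ha : ∑ j, a j ^ 2 ≤ q ^ 2) : ∑ j, |a j| ≤ √(M : ℝ) * q := by
  refine abs_le_of_sq_le_sq' ?_ (by positivity) |>.2
  have h := sq_sum_le_card_mul_sum_sq (s := Finset.univ) (f := fun j => |a j|)
  simp only [sq_abs, Finset.card_univ, Fintype.card_fin] at h
  rw [mul_pow, Real.sq_sqrt (Nat.cast_nonneg M)]
  exact h.trans (mul_le_mul_of_nonneg_left ha (Nat.cast_nonneg M))

/-- Comparison of the second moments of the output in terms of those of the last hidden layer. -/
lemma abs_outputMoment_sub_le {M : ℕ} (hM : 1 ≤ M) {m d A B Δ : Fin M → ℝ} {G D s q : ℝ}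
    (hq : 0 < q) (hmd : ∑ j, (m j ^ 2 + (d j - 1) ^ 2) ≤ q ^ 2) (hG0 : 0 ≤ G)
    (hG : G ≤ 2 * ∑ j, m j ^ 2 * B j + 2 * q ^ 2 * D) (hΔ : ∀ j, 0 ≤ Δ j) (hD : ∑ j, Δ j ≤ D)
    (hB : ∀ j, B j ≤ s) (hs : 0 ≤ s)
    (hAB : ∀ t > 0, ∀ j, |A j - B j| ≤ (1 + t) * Δ j + B j / t)
    (hA : ∀ j, A j ≤ 2 * B j + 2 * Δ j) (hA0 : ∀ j, 0 ≤ A j) :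
    |G + ∑ j, d j ^ 2 * A j - ∑ j, B j|
      ≤ 2 * q ^ 2 * s + 2 * q ^ 2 * D + 2 * s * (2 * (√(M : ℝ) * q) + q ^ 2)
        + 2 * (2 * q + q ^ 2) * D + D + √(M : ℝ) / q * D + √(M : ℝ) * q * s := by
  have hM' : 0 < √(M : ℝ) := Real.sqrt_pos.2 (by exact_mod_cast hM)
  rw [Finset.sum_add_distrib] at hmd
  have hm0 : 0 ≤ ∑ j, m j ^ 2 := Finset.sum_nonneg fun _ _ => sq_nonneg _
  have hd0 : 0 ≤ ∑ j, (d j - 1) ^ 2 := Finset.sum_nonneg fun _ _ => sq_nonneg _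
  have hD0 : 0 ≤ D := (Finset.sum_nonneg fun j _ => hΔ j).trans hD
  have hm : ∑ j, m j ^ 2 ≤ q ^ 2 := by linarith
  have hd : ∑ j, (d j - 1) ^ 2 ≤ q ^ 2 := by linarith
  have hG' : G ≤ 2 * q ^ 2 * s + 2 * q ^ 2 * D := by
    have h1 : ∑ j, m j ^ 2 * B j ≤ ∑ j, m j ^ 2 * s :=
      Finset.sum_le_sum fun j _ => mul_le_mul_of_nonneg_left (hB j) (sq_nonneg _)
    rw [← Finset.sum_mul] at h1
    have h2 := mul_le_mul_of_nonneg_right hm hs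
    linarith
  have hdj : ∀ j, |d j - 1| ≤ q := fun j => by
    refine abs_le_of_sq_le_sq ?_ hq.le
    exact (Finset.single_le_sum (f := fun j => (d j - 1) ^ 2) (fun _ _ => sq_nonneg _)
      (Finset.mem_univ j)).trans hd
  have hw : ∀ j, |(d j ^ 2 - 1) * A j|
      ≤ 2 * s * (2 * |d j - 1| + (d j - 1) ^ 2) + 2 * (2 * q + q ^ 2) * Δ j := fun j => by
    have h1 : |d j ^ 2 - 1| ≤ 2 * |d j - 1| + (d j - 1) ^ 2 := by
      have : d j ^ 2 - 1 = 2 * (d j - 1) + (d j - 1) ^ 2 := by ring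
      rw [this]
      refine (abs_add_le _ _).trans ?_
      rw [abs_mul, abs_two, abs_of_nonneg (sq_nonneg (d j - 1))]
    have h2 : 2 * |d j - 1| + (d j - 1) ^ 2 ≤ 2 * q + q ^ 2 := by
      have := hdj j
      rw [← sq_abs (d j - 1)]
      gcongr
    have h0 : 0 ≤ 2 * |d j - 1| + (d j - 1) ^ 2 := by positivity
    rw [abs_mul, abs_of_nonneg (hA0 j)]
    calc _ ≤ (2 * |d j - 1| + (d j - 1) ^ 2) * (2 * s + 2 * Δ j) :=
          mul_le_mul h1 ((hA j).trans (by linarith [hB j])) (hA0 j) h0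
      _ ≤ _ := by
          have := mul_le_mul_of_nonneg_right h2 (hΔ j)
          linarith
  have hw' : ∑ j, |(d j ^ 2 - 1) * A j|
      ≤ 2 * s * (2 * (√(M : ℝ) * q) + q ^ 2) + 2 * (2 * q + q ^ 2) * D := by
    refine (Finset.sum_le_sum fun j _ => hw j).trans ?_
    rw [Finset.sum_add_distrib, ← Finset.mul_sum, ← Finset.mul_sum, Finset.sum_add_distrib,
      ← Finset.mul_sum]
    have := sum_abs_le_sqrt_mul hq.le hd
    gcongr
  -- With $D$ of order $q^2$ and $\sum_jB_j\le Ms$, the weight $t=\sqrt M/q$ makes $tD$ and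
  -- $\sum_jB_j/t$ both of order $\sqrt M\,q$.
  have ht : 0 < √(M : ℝ) / q := by positivity
  have hAB' : ∑ j, |A j - B j| ≤ D + √(M : ℝ) / q * D + √(M : ℝ) * q * s := by
    refine (Finset.sum_le_sum fun j _ => hAB _ ht j).trans ?_
    rw [Finset.sum_add_distrib, ← Finset.mul_sum, ← Finset.sum_div]
    have h1 : ∑ j, B j ≤ M * s := by
      simpa using Finset.sum_le_sum fun j (_ : j ∈ Finset.univ) => hB j
    have h2 : (∑ j, B j) / (√(M : ℝ) / q) ≤ √(M : ℝ) * q * s := by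
      rw [div_le_iff₀ ht]
      have : √(M : ℝ) * q * s * (√(M : ℝ) / q) = (√(M : ℝ)) ^ 2 * s := by field_simp
      rwa [this, Real.sq_sqrt (Nat.cast_nonneg M)]
    have h3 : (1 + √(M : ℝ) / q) * ∑ j, Δ j ≤ (1 + √(M : ℝ) / q) * D := by gcongr
    linarith
  -- Three errors: mean output weights, output standard deviations, and the change of the last
  -- hidden layer.
  have e : G + ∑ j, d j ^ 2 * A j - ∑ j, B j
      = G + ∑ j, (d j ^ 2 - 1) * A j + ∑ j, (A j - B j) := by
    simp only [sub_mul, one_mul, Finset.sum_sub_distrib]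
    ring
  rw [e]
  refine (abs_add_three _ _ _).trans ?_
  rw [abs_of_nonneg hG0]
  have a1 := (Finset.abs_sum_le_sum_abs (fun j => (d j ^ 2 - 1) * A j) Finset.univ).trans hw'
  have a2 := (Finset.abs_sum_le_sum_abs (fun j => A j - B j) Finset.univ).trans hAB'
  linarith

/-- After inserting $s\le E$ and $D\le q^2E$, every monomial is at most $wqr^3E$, because $q\le r$
and $w,r\ge1$. The coefficients add up to $2+2+(4+2)+(4+2)+1+1+1=19$. -/
lemma outputMoment_bound_le {w q r s D E : ℝ} (hw : 1 ≤ w) (hq : 0 < q) (hqr : q ≤ r) (hr : 1 ≤ r)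
    (hE : 0 ≤ E) (hs : s ≤ E) (hD : D ≤ q ^ 2 * E) :
    2 * q ^ 2 * s + 2 * q ^ 2 * D + 2 * s * (2 * (w * q) + q ^ 2)
        + 2 * (2 * q + q ^ 2) * D + D + w / q * D + w * q * s ≤ 19 * (w * q * r ^ 3 * E) := by
  have hr3 : 1 ≤ r ^ 3 := one_le_pow₀ hr
  have b1 : w * q * E ≤ w * q * r ^ 3 * E := by
    have : w * q * 1 * E ≤ w * q * r ^ 3 * E := by gcongr
    simpa using this
  have b2 : q * q * E ≤ w * q * r ^ 3 * E := by
    have h1 : q ≤ r ^ 3 := hqr.trans (le_self_pow₀ hr (by norm_num))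
    have : 1 * q * q * E ≤ w * q * r ^ 3 * E := by gcongr
    simpa using this
  have b3 : q * q ^ 2 * E ≤ w * q * r ^ 3 * E := by
    have h1 : q ^ 2 ≤ r ^ 3 :=
      (pow_le_pow_left₀ hq.le hqr 2).trans (pow_le_pow_right₀ hr (by norm_num))
    have : 1 * q * q ^ 2 * E ≤ w * q * r ^ 3 * E := by gcongr
    simpa using this
  have b4 : q * q ^ 3 * E ≤ w * q * r ^ 3 * E := by
    have h1 : q ^ 3 ≤ r ^ 3 := pow_le_pow_left₀ hq.le hqr 3
    have : 1 * q * q ^ 3 * E ≤ w * q * r ^ 3 * E := by gcongr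
    simpa using this
  have hq2 : 0 ≤ q ^ 2 := sq_nonneg q
  have c1 : q ^ 2 * s ≤ q ^ 2 * E := by gcongr
  have c2 : q ^ 2 * D ≤ q ^ 2 * (q ^ 2 * E) := by gcongr
  have c3 : w * q * s ≤ w * q * E := by gcongr
  have c4 : q * D ≤ q * (q ^ 2 * E) := by gcongr
  have c5 : w / q * D ≤ w / q * (q ^ 2 * E) := by gcongr
  have c6 : w / q * (q ^ 2 * E) = w * q * E := by field_simp
  nlinarith

end Output

/-! ### Output moments of the network under the coupling -/

section Main

/-- The subtracted terms remove the output bias and centre the last activations, leaving a linear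
form in the output weights. -/
lemma networkTilde_eq {Di Do M L : ℕ} (hL : 1 ≤ L) (φ : ℝ → ℝ) (α : ℝ) (θ : Params Di Do M L)
    (x : EuclideanSpace ℝ (Fin Di)) (i : Fin Do) :
    networkTilde hL φ α θ x i = ∑ j, θ (.outWeight i j)
      * (1 / √(M : ℝ) * (φ (preact φ θ x (L - 1) (by omega) j) - α)) := by
  simp only [networkTilde, network, mul_sub, Finset.sum_sub_distrib, Finset.mul_sum]
  rw [add_sub_right_comm, add_sub_cancel_right]
  congr 1 <;> exact Finset.sum_congr rfl fun j _ => by ring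

variable {Di Do M L : ℕ} (hL : 1 ≤ L) {φ : ℝ → ℝ} {α : ℝ} (x : EuclideanSpace ℝ (Fin Di))

lemma networkTilde_reparam_moment (hφ : LipschitzWith 1 φ) (α : ℝ)
    (μ σ : ParamIdx Di Do M L → ℝ) (i : Fin Do) :
    SqIntegrableOn Set.univ (fun ω => networkTilde hL φ α (reparam μ σ ω) x i) ∧
    ∫ ω, networkTilde hL φ α (reparam μ σ ω) x i ^ 2 ∂stdPrior (ParamIdx Di Do M L)
      = 1 / (M : ℝ) * (∫ ω, (∑ j, μ (.outWeight i j)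
            * (φ (preact φ (reparam μ σ ω) x (L - 1) (by omega) j) - α)) ^ 2
              ∂stdPrior (ParamIdx Di Do M L)
          + ∑ j, σ (.outWeight i j) ^ 2
            * ∫ ω, (φ (preact φ (reparam μ σ ω) x (L - 1) (by omega) j) - α) ^ 2
              ∂stdPrior (ParamIdx Di Do M L)) := by
  have hk : Function.Injective fun j : Fin M => (ParamIdx.outWeight i j : ParamIdx Di Do M L) :=
    fun a b h => by simpa using h
  have hkS : ∀ j : Fin M, (ParamIdx.outWeight i j) ∉ layersUpTo Di Do M L (L - 1) := fun j h => by
    have : L ≤ L - 1 := h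
    omega
  have hc := fun j => (centered_sqIntegrableOn (Do := Do) (M := M) x hφ α μ σ (L - 1)
    (by omega) j).const_mul (1 / √(M : ℝ))
  obtain ⟨h1, h2⟩ := integral_sum_affine_eval_mul_sq hk hkS (fun j => μ (.outWeight i j))
    (fun j => σ (.outWeight i j)) hc
  simp only [networkTilde_eq]
  refine ⟨h1.mono (Set.subset_univ _), h2.trans ?_⟩
  have e : ∀ ω : Params Di Do M L, ∑ j, μ (.outWeight i j) * (1 / √(M : ℝ)
      * (φ (preact φ (reparam μ σ ω) x (L - 1) (by omega) j) - α)) = 1 / √(M : ℝ) *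
      ∑ j, μ (.outWeight i j) * (φ (preact φ (reparam μ σ ω) x (L - 1) (by omega) j) - α) :=
    fun ω => by
      rw [Finset.mul_sum]
      exact Finset.sum_congr rfl fun j _ => by ring
  simp only [e, mul_pow, integral_const_mul, div_pow, one_pow, Real.sq_sqrt (Nat.cast_nonneg M)]
  rw [mul_add, Finset.mul_sum]
  congr 1
  exact Finset.sum_congr rfl fun j _ => by ring

lemma networkTilde_std_moment (hφ : LipschitzWith 1 φ) (α : ℝ) (i : Fin Do) :
    SqIntegrableOn Set.univ (fun ω : Params Di Do M L => networkTilde hL φ α ω x i) ∧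
    ∫ ω, networkTilde hL φ α ω x i ^ 2 ∂stdPrior (ParamIdx Di Do M L)
      = 1 / (M : ℝ) * ∑ j, ∫ ω, (φ (preact φ ω x (L - 1) (by omega) j) - α) ^ 2
              ∂stdPrior (ParamIdx Di Do M L) := by
  have h := networkTilde_reparam_moment (M := M) hL x hφ α (fun _ => 0) (fun _ => 1) i
  simpa only [reparam_zero_one, zero_mul, Finset.sum_const_zero, one_pow, one_mul, ne_eq,
    OfNat.ofNat_ne_zero, not_false_eq_true, zero_pow, integral_zero, zero_add] using h

/-- Width-dependent comparison of the output second moments under the coupling. -/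
theorem abs_networkTilde_moment_sub_le (hM : 1 ≤ M) (hφ : LipschitzWith 1 φ)
    (hα : ∀ a, evenPart φ a = α) (μ σ : ParamIdx Di Do M L → ℝ) {q r : ℝ} (hq : 0 < q)
    (hqr : q ≤ r) (hr : 1 ≤ r) (hK : ∑ k, (μ k ^ 2 + (σ k - 1) ^ 2) ≤ q ^ 2) (i : Fin Do) :
    |∫ ω, networkTilde hL φ α (reparam μ σ ω) x i ^ 2 ∂stdPrior (ParamIdx Di Do M L)
        - ∫ ω, networkTilde hL φ α ω x i ^ 2 ∂stdPrior (ParamIdx Di Do M L)|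
      ≤ 19 * (q * r ^ 3 * (inputScale α x * (r ^ 2) ^ (L - 1) * 10 ^ L)) / √(M : ℝ) := by
  have hM' : (0 : ℝ) < M := by exact_mod_cast hM
  have hw : 1 ≤ √(M : ℝ) := Real.one_le_sqrt.2 (by exact_mod_cast hM)
  have hl : L - 1 < L := by omega
  have hlL : L - 1 + 1 = L := by omega
  have hX0 := inputScale_pos x α
  have hr2 : 1 ≤ r ^ 2 := one_le_pow₀ hr
  have hD := couplingDist_le φ x hM hφ hα μ σ hK hr2 (pow_le_pow_left₀ hq.le hqr 2) (L - 1) hl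
  rw [hlL] at hD
  have hcQ := centered_sqIntegrableOn (Do := Do) (M := M) x hφ α μ σ (L - 1) hl
  have hcP := centered_sqIntegrableOn_std (Do := Do) (M := M) x hφ α (L - 1) hl
  have hzQ := preact_sqIntegrableOn φ x hφ μ σ (L - 1) hl
  have hzP := preact_sqIntegrableOn_std (Do := Do) (M := M) φ x hφ (L - 1) hl
  rw [(networkTilde_reparam_moment hL x hφ α μ σ i).2, (networkTilde_std_moment hL x hφ α i).2,
    ← mul_sub, abs_mul, abs_of_pos (by positivity : 0 < 1 / (M : ℝ))]
  have hΔD : ∑ j, ∫ ω, ((φ (preact φ (reparam μ σ ω) x (L - 1) hl j) - α)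
      - (φ (preact φ ω x (L - 1) hl j) - α)) ^ 2 ∂stdPrior (ParamIdx Di Do M L)
      ≤ couplingDist φ x μ σ (L - 1) hl := by
    refine Finset.sum_le_sum fun j _ => integral_mono ((hcQ j).sub (hcP j)).integrable_sq
      ((hzQ j).sub (hzP j)).integrable_sq fun ω => ?_
    simp only [sub_sub_sub_cancel_right]
    exact activation_sub_sq_le hφ _ _
  have hB : ∀ j, ∫ ω, (φ (preact φ ω x (L - 1) hl j) - α) ^ 2 ∂stdPrior (ParamIdx Di Do M L)
      ≤ 3 ^ L * inputScale α x := fun j => by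
    have h1 := integral_preact_sq_le (Do := Do) φ x hM hφ hα (L - 1) hl j
    rw [hlL] at h1
    exact (integral_mono (hcP j).integrable_sq (hzP j).integrable_sq
      fun ω => activation_centered_sq_le hφ hα _).trans h1
  have hmd : ∑ j, (μ (.outWeight i j) ^ 2 + (σ (.outWeight i j) - 1) ^ 2) ≤ q ^ 2 :=
    (sum_comp_le_sum_of_injective
      (e := fun j : Fin M => (ParamIdx.outWeight i j : ParamIdx Di Do M L))
      (fun a b h => by simpa using h) (fun k => by positivity)).trans hK
  have hG : ∫ ω, (∑ j, μ (.outWeight i j)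
      * (φ (preact φ (reparam μ σ ω) x (L - 1) hl j) - α)) ^ 2 ∂stdPrior (ParamIdx Di Do M L)
      ≤ 2 * ∑ j, μ (.outWeight i j) ^ 2 * ∫ ω, (φ (preact φ ω x (L - 1) hl j) - α) ^ 2
        ∂stdPrior (ParamIdx Di Do M L) + 2 * q ^ 2 * couplingDist φ x μ σ (L - 1) hl := by
    have h1 := integral_sq_add_le
      (SqIntegrableOn.sum Finset.univ fun j => (hcP j).const_mul (μ (.outWeight i j)))
      (SqIntegrableOn.sum Finset.univ fun j => ((hcQ j).sub (hcP j)).const_mul (μ (.outWeight i j)))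
    have h2 := integral_sum_mul_sq_le (fun j => μ (.outWeight i j)) fun j => (hcQ j).sub (hcP j)
    -- Orthogonality is available only under the prior, so the posterior form is split: the prior
    -- part is diagonal, and Cauchy–Schwarz suffices for the difference, whose total size does not
    -- grow with $M$.
    rw [integral_sum_mul_centered_sq x hφ hα] at h1
    simp only [← Finset.sum_add_distrib, ← mul_add, add_sub_cancel] at h1
    have hm : ∑ j, μ (.outWeight i j) ^ 2 ≤ q ^ 2 :=
      (Finset.sum_le_sum fun j _ => by nlinarith [sq_nonneg (σ (.outWeight i j) - 1)]).trans hmd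
    have h3 := mul_le_mul hm hΔD
      (Finset.sum_nonneg fun _ _ => integral_nonneg fun _ => sq_nonneg _) (sq_nonneg q)
    linarith
  have hAB : ∀ t > 0, ∀ j, |∫ ω, (φ (preact φ (reparam μ σ ω) x (L - 1) hl j) - α) ^ 2
        ∂stdPrior (ParamIdx Di Do M L)
      - ∫ ω, (φ (preact φ ω x (L - 1) hl j) - α) ^ 2 ∂stdPrior (ParamIdx Di Do M L)|
      ≤ (1 + t) * ∫ ω, ((φ (preact φ (reparam μ σ ω) x (L - 1) hl j) - α)
      - (φ (preact φ ω x (L - 1) hl j) - α)) ^ 2 ∂stdPrior (ParamIdx Di Do M L)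
      + (∫ ω, (φ (preact φ ω x (L - 1) hl j) - α) ^ 2 ∂stdPrior (ParamIdx Di Do M L)) / t := by
    intro t ht j
    have i1 := ((hcQ j).sub (hcP j)).integrable_sq.const_mul (1 + t)
    have i2 := (hcP j).integrable_sq.div_const t
    rw [← integral_sub (hcQ j).integrable_sq (hcP j).integrable_sq, ← integral_const_mul,
      ← integral_div, ← integral_add i1 i2]
    refine abs_integral_le_integral_abs.trans (integral_mono
      ((hcQ j).integrable_sq.sub (hcP j).integrable_sq).abs (i1.add i2) fun ω => ?_)
    simp only
    exact abs_sq_sub_sq_le ht _ _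
  have hA : ∀ j, ∫ ω, (φ (preact φ (reparam μ σ ω) x (L - 1) hl j) - α) ^ 2
        ∂stdPrior (ParamIdx Di Do M L)
      ≤ 2 * ∫ ω, (φ (preact φ ω x (L - 1) hl j) - α) ^ 2 ∂stdPrior (ParamIdx Di Do M L)
      + 2 * ∫ ω, ((φ (preact φ (reparam μ σ ω) x (L - 1) hl j) - α)
      - (φ (preact φ ω x (L - 1) hl j) - α)) ^ 2 ∂stdPrior (ParamIdx Di Do M L) := fun j => by
    have := integral_sq_add_le (hcP j) ((hcQ j).sub (hcP j))
    simpa only [add_sub_cancel] using this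
  have key := abs_outputMoment_sub_le hM hq hmd (integral_nonneg fun _ => sq_nonneg _) hG
    (fun j => integral_nonneg fun _ => sq_nonneg _) hΔD hB (by positivity) hAB hA
    (fun j => integral_nonneg fun _ => sq_nonneg _)
  have hE : 0 ≤ inputScale α x * (r ^ 2) ^ (L - 1) * 10 ^ L := by positivity
  have hs : 3 ^ L * inputScale α x ≤ inputScale α x * (r ^ 2) ^ (L - 1) * 10 ^ L := by
    have h1 : (1 : ℝ) ≤ (r ^ 2) ^ (L - 1) := one_le_pow₀ hr2
    have h2 : inputScale α x * 1 * 3 ^ L ≤ inputScale α x * (r ^ 2) ^ (L - 1) * 10 ^ L := by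
      gcongr
      norm_num
    linarith
  have hD' : couplingDist φ x μ σ (L - 1) hl
      ≤ q ^ 2 * (inputScale α x * (r ^ 2) ^ (L - 1) * 10 ^ L) := by
    simpa only [mul_assoc] using hD
  have key2 := key.trans (outputMoment_bound_le hw hq hqr hr hE hs hD')
  refine (mul_le_mul_of_nonneg_left key2 (by positivity)).trans_eq ?_
  have hsq : (M : ℝ) = √(M : ℝ) * √(M : ℝ) := (Real.mul_self_sqrt hM'.le).symm
  rw [one_div, inv_mul_eq_div, div_eq_div_iff hM'.ne' (by positivity)]
  nth_rewrite 3 [hsq]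
  ring

end Main

/-! ### Numerical bounds on the constants -/

section Constants

lemma cOne_bounds : 51 < cOne ∧ cOne < 52 := by
  have h1 : 1.41 < √2 := Real.lt_sqrt_of_sq_lt (by norm_num)
  have h2 : √2 < 1.42 := (Real.sqrt_lt' (by norm_num)).2 (by norm_num)
  unfold cOne
  constructor <;> linarith

lemma rho_bounds_of_mem {ρ α : ℝ} {M : ℕ} (h : ρ = rho α M ∨ ρ = rhoSwap α M) :
    17 < ρ ∧ ρ < 97 := by
  have p1 : 2 < √(2 * Real.pi) := Real.lt_sqrt_of_sq_lt (by linarith [Real.pi_gt_three])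
  have p2 : √(2 * Real.pi) < 3 := (Real.sqrt_lt' (by norm_num)).2 (by linarith [Real.pi_lt_four])
  have a1 : 6.5 < √43 := Real.lt_sqrt_of_sq_lt (by norm_num)
  have a2 : √43 < 7 := (Real.sqrt_lt' (by norm_num)).2 (by norm_num)
  have b1 : 28 < √793 := Real.lt_sqrt_of_sq_lt (by norm_num)
  have b2 : √793 < 29 := (Real.sqrt_lt' (by norm_num)).2 (by norm_num)
  have c1 : 48 < √2353 := Real.lt_sqrt_of_sq_lt (by norm_num)
  have c2 : √2353 < 49 := (Real.sqrt_lt' (by norm_num)).2 (by norm_num)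
  rcases h with rfl | rfl
  · unfold rho
    split_ifs <;> constructor <;> linarith
  · unfold rhoSwap
    split_ifs <;> constructor <;> linarith

end Constants

theorem mainTheorem3 {Di Do M L : ℕ} (hDi : 1 ≤ Di) (hM : 1 ≤ M) (hL : 1 ≤ L)
    (φ : ℝ → ℝ) (hφ : LipschitzWith 1 φ) (α : ℝ) (hα : ∀ a, evenPart φ a = α)
    (μ : ParamIdx Di Do M L → ℝ) (v : ParamIdx Di Do M L → ℝ≥0) (hv : ∀ i, 0 < v i)
    (Q P : Measure (Params Di Do M L))
    (hQ : Q = meanFieldGaussian μ v) (hP : P = stdPrior (ParamIdx Di Do M L))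
    (x : EuclideanSpace ℝ (Fin Di)) :
    InformationTheory.klDiv Q P ≠ ∞ ∧
    (∀ i, Integrable (fun θ => networkTilde hL φ α θ x i ^ 2) Q) ∧
    (∀ i, Integrable (fun θ => networkTilde hL φ α θ x i ^ 2) P) ∧
    (51 < cOne ∧ cOne < 52) ∧
    ∀ ρ : ℝ, ρ = rho α M ∨ ρ = rhoSwap α M →
      (17 < ρ ∧ ρ < 97) ∧
      ‖(fun i => (∫ θ, networkTilde hL φ α θ x i ^ 2 ∂Q)
          - ∫ θ, networkTilde hL φ α θ x i ^ 2 ∂P : Fin Do → ℝ)‖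
        ≤ cOne * (L : ℝ) ^ (1 / 2 : ℝ) * ρ ^ L
          * ((α ^ 2 + 1 + 1 / (Di : ℝ) * ‖x‖ ^ 2) / √(M : ℝ))
          * √(InformationTheory.klDiv Q P).toReal
          * (max (2 * (InformationTheory.klDiv Q P).toReal) 1) ^ ((L : ℝ) + 1 / 2) := by
  have hkl := klDiv_meanFieldGaussian_stdPrior μ v hv
  rw [← hQ, ← hP] at hkl
  obtain ⟨hfin, hK⟩ := hkl
  set σ : ParamIdx Di Do M L → ℝ := fun k => √(v k : ℝ) with hσ
  have hmap : P.map (reparam μ σ) = Q := by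
    rw [hQ, hP]
    exact map_affine_stdPrior μ v
  have hmr : Measurable (reparam μ σ) :=
    measurable_pi_lambda _ fun k => ((measurable_pi_apply k).const_mul _).const_add _
  have hstd := fun i => (networkTilde_std_moment (Di := Di) (Do := Do) (M := M) hL x hφ α i).1
  have hrep := fun i => (networkTilde_reparam_moment hL x hφ α μ σ i).1
  have hmeas : ∀ i, Measurable fun θ : Params Di Do M L => networkTilde hL φ α θ x i ^ 2 :=
    fun i => (hstd i).measurable.pow_const 2
  have hintQ : ∀ i, ∫ θ, networkTilde hL φ α θ x i ^ 2 ∂Q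
      = ∫ ω, networkTilde hL φ α (reparam μ σ ω) x i ^ 2 ∂stdPrior (ParamIdx Di Do M L) :=
    fun i => by
      rw [← hmap, integral_map hmr.aemeasurable (hmeas i).aestronglyMeasurable, hP]
  refine ⟨hfin, fun i => ?_, fun i => ?_, cOne_bounds, fun ρ hρ => ⟨rho_bounds_of_mem hρ, ?_⟩⟩
  · rw [← hmap, integrable_map_measure (hmeas i).aestronglyMeasurable hmr.aemeasurable, hP]
    exact (hrep i).integrable_sq
  · rw [hP]
    exact (hstd i).integrable_sq
  have hρ17 := (rho_bounds_of_mem hρ).1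
  have hc := cOne_bounds.1
  have hX0 := inputScale_pos x α
  change _ ≤ cOne * (L : ℝ) ^ (1 / 2 : ℝ) * ρ ^ L * (inputScale α x / √(M : ℝ)) * _ * _
  set KL := (InformationTheory.klDiv Q P).toReal with hKL
  have hKL0 : 0 ≤ KL := ENNReal.toReal_nonneg
  have hmax : 0 < max (2 * KL) 1 := lt_max_of_lt_right one_pos
  rw [pi_norm_le_iff_of_nonneg (by positivity)]
  intro i
  -- Zero divergence is separate because the weight $\sqrt M/q$ needs $q>0$; in that case $Q=P$ and
  -- the difference vanishes.
  rcases hKL0.eq_or_lt with h0 | hpos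
  · have hz : InformationTheory.klDiv Q P = 0 := by
      rcases (ENNReal.toReal_eq_zero_iff _).1 h0.symm with h | h
      · exact h
      · exact absurd h hfin
    have : IsFiniteMeasure Q := by rw [hQ]; infer_instance
    have : IsFiniteMeasure P := by rw [hP]; infer_instance
    rw [InformationTheory.klDiv_eq_zero_iff] at hz
    rw [hz, sub_self, norm_zero]
    positivity
  · have hq : 0 < √(2 * KL) := Real.sqrt_pos.2 (by linarith)
    have hqr : √(2 * KL) ≤ √(max (2 * KL) 1) := Real.sqrt_le_sqrt (le_max_left _ _)
    have hr : 1 ≤ √(max (2 * KL) 1) := Real.one_le_sqrt.2 (le_max_right _ _)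
    have hr2 : √(max (2 * KL) 1) ^ 2 = max (2 * KL) 1 := Real.sq_sqrt hmax.le
    rw [hintQ i, hP, Real.norm_eq_abs]
    refine (abs_networkTilde_moment_sub_le hL x hM hφ hα μ σ hq hqr hr
      (by rw [Real.sq_sqrt (by linarith)]; exact hK) i).trans ?_
    set r := √(max (2 * KL) 1) with hrdef
    -- The output layer contributes $r^3$ and the $L-1$ hidden transitions $r^{2(L-1)}$; together
    -- $r^{2L+1}$ with $r^2=\max(2\,\mathrm{KL},1)$.
    have hpow : (max (2 * KL) 1) ^ ((L : ℝ) + 1 / 2) = r ^ 3 * (r ^ 2) ^ (L - 1) := by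
      rw [Real.rpow_add hmax, Real.rpow_natCast, ← Real.sqrt_eq_rpow, ← hrdef, ← hr2]
      obtain ⟨n, rfl⟩ : ∃ n, L = n + 1 := ⟨L - 1, by omega⟩
      rw [Nat.add_sub_cancel]
      ring
    have hs2 : √2 < 1.42 := (Real.sqrt_lt' (by norm_num)).2 (by norm_num)
    have hL1 : 1 ≤ (L : ℝ) ^ (1 / 2 : ℝ) :=
      Real.one_le_rpow (by exact_mod_cast hL) (by norm_num)
    -- Only $c_1>51$, $\rho>17$ and $L^{1/2}\ge1$ are needed, so both tables are covered at once.
    -- The factor $\sqrt2$ comes from $q=\sqrt{2\,\mathrm{KL}}$.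
    have hcoef : 19 * √2 * 10 ^ L ≤ cOne * (L : ℝ) ^ (1 / 2 : ℝ) * ρ ^ L := by
      have h1 : 19 * √2 ≤ cOne * 1 := by linarith
      have h3 : cOne * 1 ≤ cOne * (L : ℝ) ^ (1 / 2 : ℝ) := by gcongr
      have h2 : (10 : ℝ) ^ L ≤ ρ ^ L := pow_le_pow_left₀ (by norm_num) (by linarith) L
      exact mul_le_mul (h1.trans h3) h2 (by positivity) (by positivity)
    rw [hpow, Real.sqrt_mul (by norm_num : (0 : ℝ) ≤ 2)]
    calc _ = 19 * √2 * 10 ^ L * (inputScale α x / √(M : ℝ)) * √KL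
          * (r ^ 3 * (r ^ 2) ^ (L - 1)) := by ring
      _ ≤ _ := by gcongr
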